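/- For a finite set (spherical code) $C\subset\mathbb{S}^{n-1}=\{x\in\mathbb{R}^n:\|x\|=1\}$ let $I(C)=\{x\cdot y: x,y\in C,\ x\ne y\}$ and, for $x\in C$, $A_t(x)=|\{y\in C: x\cdot y=t\}|$; $C$ is distance invariant if for every $t\in I(C)$ the number $A_t(x)$ is the same for all $x\in C$. For $T\subset[-1,1)$, $C$ is called $T$-avoiding if $I(C)\cap T=\emptyset$. A nonempty $C$ is a spherical $\tau$-design if every real polynomial in $n$ variables of total degree at most $\tau$ has the same average over $C$ as over $\mathbb{S}^{n-1}$ with respect to normalized surface measure. A potential $h:[-1,1)\to\mathbb{R}$ is called absolutely monotone if it is continuous on $[-1,1)$, infinitely differentiable on $(-1,1)$, and $h^{(j)}\ge 0$ on $(-1,1)$ for all $j\ge 1$. The $h$-energy of $C$ is $E_h(C)=\sum_{x\ne y\in C}h(x\cdot y)$ (sum over ordered pairs), and $\mathcal{E}_h(n,N;T)$ is the minimum of $E_h(C)$ over all $T$-avoiding spherical codes $C\subset\mathbb{S}^{n-1}$ with $|C|=N$. A $T$-avoiding code $C$ is $T$-avoiding universally optimal if for every absolutely monotone $h$ it minimizes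 the $h$-energy among all $T$-avoiding codes of cardinality $|C|$. Let $C_{BW}\subset\mathbb{S}^{15}$ be the kissing configuration of the Barnes–Wall lattice in $\mathbb{R}^{16}$, that is, its minimal nonzero vectors rescaled to unit length; here the lattice consists of all $2^{-1/2}z$ with $z\in\mathbb{Z}^{16}$, $z \bmod 2$ in the first-order Reed–Muller code of length $16$, and $\sum_i z_i\equiv 0 \pmod 4$. **Theorem.** Let $T$ be any of the sets $$\left(-\tfrac12,-\tfrac14\right)\cup\left(\tfrac14,\tfrac12\right),\quad \left(-\tfrac14,0\right)\cup\left(\tfrac14,\tfrac12\right),\quad \left(-\tfrac12,-\tfrac14\right)\cup\left(0,\tfrac14\right).$$ Let $h$ be absolutely monotone with $h^{(8)}>0$ on $(-1,1)$. Then for every $T$-avoiding spherical code $C\subset\mathbb{S}^{15}$ with $|C|=4320$, $$E_h(C)\ \ge\ \mathcal{E}_h(16,4320;T)=4320\left(280\left(h(-\tfrac12)+h(\tfrac12)\right)+1024\left(h(-\tfrac14)+h(\tfrac14)\right)+1710\,h(0)+h(-1)\right),$$ the minimum being attained. Equality holds whenever $C\subset\mathbb{S}^{15}$ is a spherical $7$-design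 with $|C|=4320$ and $I(C)=\{-1,-\tfrac12,-\tfrac14,0,\tfrac14,\tfrac12\}$; every such $C$ is distance invariant with $A_{-1}=1$, $A_{\pm1/2}=280$, $A_{\pm1/4}=1024$, $A_0=1710$. Equality also holds for $C_{BW}$, which has $4320$ points and these same inner products and distance distribution. Moreover, $C_{BW}$ is $T$-avoiding universally optimal. -/

import Mathlib

noncomputable section

/-! ### Spherical codes and their inner products -/

/-- A finite set of points of the unit sphere `𝕊^{n-1} ⊆ ℝⁿ`. -/
def IsSphericalCode {n : ℕ} (C : Finset (EuclideanSpace ℝ (Fin n))) : Prop :=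
  ∀ x ∈ C, ‖x‖ = 1

/-- `I(C)`: the set of inner products of distinct points of `C`. -/
def innerProducts {n : ℕ} (C : Finset (EuclideanSpace ℝ (Fin n))) : Set ℝ :=
  {t | ∃ x ∈ C, ∃ y ∈ C, x ≠ y ∧ inner ℝ x y = t}

/-- `C` is `T`-avoiding: `I(C) ∩ T = ∅`. -/
def IsAvoiding {n : ℕ} (T : Set ℝ) (C : Finset (EuclideanSpace ℝ (Fin n))) : Prop :=
  innerProducts C ∩ T = ∅

open Classical in
/-- `A_t(x)`: the number of points of `C` having inner product `t` with `x`. -/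
def distanceCount {n : ℕ} (C : Finset (EuclideanSpace ℝ (Fin n)))
    (x : EuclideanSpace ℝ (Fin n)) (t : ℝ) : ℕ :=
  (C.filter fun y => inner ℝ x y = t).card

/-- For each `t ∈ I(C)`, the number `A_t(x)` does not depend on the choice of `x ∈ C`. -/
def IsDistanceInvariant {n : ℕ} (C : Finset (EuclideanSpace ℝ (Fin n))) : Prop :=
  ∀ t ∈ innerProducts C, ∀ x ∈ C, ∀ y ∈ C, distanceCount C x t = distanceCount C y t

open Classical in
/-- The `h`-energy: the sum of `h (x · y)` over ordered pairs of distinct points of `C`. -/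
def energy {n : ℕ} (h : ℝ → ℝ) (C : Finset (EuclideanSpace ℝ (Fin n))) : ℝ :=
  ∑ p ∈ C.offDiag, h (inner ℝ p.1 p.2)

/-- A spherical `τ`-design: a (nonempty) spherical code over which every polynomial of total
degree at most `τ` has the same average as over the sphere, with respect to the normalized
surface measure. -/
def IsSphericalDesign {n : ℕ} (τ : ℕ) (C : Finset (EuclideanSpace ℝ (Fin n))) : Prop :=
  IsSphericalCode C ∧ C.Nonempty ∧
    ∀ p : MvPolynomial (Fin n) ℝ, p.totalDegree ≤ τ →
      (⨍ x : Metric.sphere (0 : EuclideanSpace ℝ (Fin n)) 1,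
          MvPolynomial.eval (fun i => (x : EuclideanSpace ℝ (Fin n)) i) p
        ∂(MeasureTheory.volume : MeasureTheory.Measure (EuclideanSpace ℝ (Fin n))).toSphere)
      = (1 / (C.card : ℝ)) * ∑ x ∈ C, MvPolynomial.eval (fun i => x i) p

/-! ### Potentials and universal optimality -/

/-- Absolutely monotone potentials: `h` is real valued and continuous on `[-1,1)`, smooth on
`(-1,1)`, and `h^{(j)} ≥ 0` on `(-1,1)` for all `j ≥ 1`.
Values of `h` outside `[-1,1)` are irrelevant: distinct unit vectors have inner product in
`[-1,1)`. -/
def IsAbsolutelyMonotone (h : ℝ → ℝ) : Prop :=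
  ContinuousOn h (Set.Ico (-1) 1) ∧
    ContDiffOn ℝ ((⊤ : ℕ∞) : WithTop ℕ∞) h (Set.Ioo (-1) 1) ∧
    ∀ j : ℕ, 1 ≤ j → ∀ t ∈ Set.Ioo (-1 : ℝ) 1, 0 ≤ iteratedDeriv j h t

/-- The set of `h`-energies of `T`-avoiding spherical codes of cardinality `N` on `𝕊^{n-1}`;
its least element is the minimum energy `𝓔_h(n, N; T)`. -/
def avoidingEnergies (n N : ℕ) (T : Set ℝ) (h : ℝ → ℝ) : Set ℝ :=
  {E | ∃ C : Finset (EuclideanSpace ℝ (Fin n)),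
    IsSphericalCode C ∧ IsAvoiding T C ∧ C.card = N ∧ energy h C = E}

/-- `C` is a `T`-avoiding spherical code which, for every absolutely monotone potential,
minimizes the energy among all `T`-avoiding spherical codes of the same cardinality. -/
def IsAvoidingUniversallyOptimal {n : ℕ} (T : Set ℝ)
    (C : Finset (EuclideanSpace ℝ (Fin n))) : Prop :=
  IsSphericalCode C ∧ IsAvoiding T C ∧
    ∀ h : ℝ → ℝ, IsAbsolutelyMonotone h →
      ∀ C' : Finset (EuclideanSpace ℝ (Fin n)),
        IsSphericalCode C' → IsAvoiding T C' → C'.card = C.card → energy h C ≤ energy h C'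

/-! ### The Barnes–Wall lattice and its kissing configuration -/

/-- The nonzero vectors of `L` of least norm. -/
def minimalVectors {n : ℕ} (L : AddSubgroup (EuclideanSpace ℝ (Fin n))) :
    Set (EuclideanSpace ℝ (Fin n)) :=
  {v | v ∈ L ∧ v ≠ 0 ∧ ∀ w ∈ L, w ≠ 0 → ‖v‖ ≤ ‖w‖}

/-- The kissing configuration of `L`: its minimal vectors, rescaled to the unit sphere. -/
def kissingConfiguration {n : ℕ} (L : AddSubgroup (EuclideanSpace ℝ (Fin n))) :
    Set (EuclideanSpace ℝ (Fin n)) :=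
  (fun v => ‖v‖⁻¹ • v) '' minimalVectors L

/-- The first-order Reed–Muller code of length 16: the binary words given by the affine
functions on `𝔽₂⁴`, a coordinate `i < 16` standing for the point of its four binary digits. -/
def reedMuller : AddSubgroup (Fin 16 → ZMod 2) where
  carrier := {c | ∃ (a : ZMod 2) (b : Fin 4 → ZMod 2),
    ∀ i : Fin 16, c i = a + ∑ j : Fin 4, if (i : ℕ).testBit j then b j else 0}
  zero_mem' := ⟨0, 0, fun i => by simp⟩
  add_mem' := by
    rintro c d ⟨a, b, h⟩ ⟨a', b', h'⟩
    refine ⟨a + a', b + b', fun i => ?_⟩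
    have : ∀ j : Fin 4, (if (i : ℕ).testBit j then (b + b') j else 0)
        = (if (i : ℕ).testBit j then b j else 0) + (if (i : ℕ).testBit j then b' j else 0) := by
      intro j; split_ifs <;> simp
    rw [Pi.add_apply, h i, h' i, Finset.sum_congr rfl fun j _ => this j, Finset.sum_add_distrib]
    ring
  neg_mem' := by
    rintro c ⟨a, b, h⟩
    refine ⟨a, b, fun i => ?_⟩
    rw [Pi.neg_apply, ZMod.neg_eq_self_mod_two]
    exact h i

/-- The Barnes–Wall lattice in `ℝ¹⁶`: the vectors `2^{-1/2} z` with `z ∈ ℤ¹⁶`, `z mod 2` in the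
first-order Reed–Muller code of length 16 and `∑ zᵢ ≡ 0 mod 4`. -/
def barnesWallLattice : AddSubgroup (EuclideanSpace ℝ (Fin 16)) where
  carrier := {v | ∃ z : Fin 16 → ℤ, (fun i => (z i : ZMod 2)) ∈ reedMuller ∧
    (4 : ℤ) ∣ ∑ i, z i ∧ ∀ i, v i = (z i : ℝ) / Real.sqrt 2}
  zero_mem' := ⟨0, by
    have : (fun i => (((0 : Fin 16 → ℤ) i : ℤ) : ZMod 2)) = 0 := by
      ext i; simp
    rw [this]
    exact reedMuller.zero_mem, by simp, by simp⟩
  add_mem' := by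
    rintro v w ⟨z, h1, h2, h3⟩ ⟨z', h1', h2', h3'⟩
    refine ⟨z + z', ?_, ?_, fun i => ?_⟩
    · have : (fun i => (((z + z') i : ℤ) : ZMod 2))
          = (fun i => (z i : ZMod 2)) + fun i => (z' i : ZMod 2) := by
        ext i; simp
      rw [this]
      exact reedMuller.add_mem h1 h1'
    · simpa [Finset.sum_add_distrib] using dvd_add h2 h2'
    · simp [h3 i, h3' i, add_div]
  neg_mem' := by
    rintro v ⟨z, h1, h2, h3⟩
    refine ⟨-z, ?_, ?_, fun i => ?_⟩
    · have : (fun i => (((-z) i : ℤ) : ZMod 2)) = -(fun i => (z i : ZMod 2)) := by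
        ext i; simp
      rw [this]
      exact reedMuller.neg_mem h1
    · simpa using h2
    · simp [h3 i, neg_div]

theorem finite_kissingConfiguration_barnesWallLattice :
    (kissingConfiguration barnesWallLattice).Finite := by
  refine Set.Finite.image _ ?_
  have hfin : (Set.pi Set.univ fun _ : Fin 16 => Set.Icc (-4 : ℤ) 4).Finite :=
    Set.Finite.pi fun _ => Set.finite_Icc _ _
  refine (hfin.image fun z : Fin 16 → ℤ =>
    (WithLp.toLp 2 fun i => (z i : ℝ) / Real.sqrt 2 : EuclideanSpace ℝ (Fin 16))).subset ?_
  rintro v ⟨⟨z, h1, h2, h3⟩, -, hmin⟩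
  have hs : (0 : ℝ) < Real.sqrt 2 := by positivity
  have hw := hmin (EuclideanSpace.single 0 (4 / Real.sqrt 2)) (by
    refine ⟨Pi.single 0 4, ?_, ?_, fun i => ?_⟩
    · have : (fun i => ((Pi.single 0 4 : Fin 16 → ℤ) i : ZMod 2)) = 0 := by
        ext i
        by_cases hi : i = 0
        · subst hi; simp; decide
        · simp [hi]
      rw [this]
      exact reedMuller.zero_mem
    · simp
    · by_cases hi : i = 0
      · subst hi; simp
      · simp [hi]) (by
    intro h0
    have := congrArg (fun u : EuclideanSpace ℝ (Fin 16) => u 0) h0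
    simp at this)
  refine ⟨z, fun i _ => ?_, ?_⟩
  · have hi : ‖v i‖ ≤ ‖v‖ := PiLp.norm_apply_le v i
    have h4 : |(z i : ℝ)| ≤ 4 := by
      have := hi.trans hw
      rw [h3 i, PiLp.norm_single, Real.norm_eq_abs, Real.norm_eq_abs, abs_div, abs_div,
        abs_of_pos hs] at this
      have := (div_le_div_iff_of_pos_right hs).1 this
      simpa using this
    have h5 : |z i| ≤ 4 := by exact_mod_cast h4
    exact abs_le.1 h5
  · ext i
    simp [h3 i]

/-- `C_BW`: the kissing configuration of the Barnes–Wall lattice, as a finite set. -/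
def barnesWallCode : Finset (EuclideanSpace ℝ (Fin 16)) :=
  finite_kissingConfiguration_barnesWallLattice.toFinset

/-! ### The data of the theorem -/

/-- The three sets `T` to be avoided. -/
def avoidedSets : Set (Set ℝ) :=
  {Set.Ioo (-1 / 2) (-1 / 4) ∪ Set.Ioo (1 / 4) (1 / 2),
   Set.Ioo (-1 / 4) 0 ∪ Set.Ioo (1 / 4) (1 / 2),
   Set.Ioo (-1 / 2) (-1 / 4) ∪ Set.Ioo 0 (1 / 4)}

/-- The inner products of the kissing configuration of the Barnes–Wall lattice. -/
def barnesWallInnerProducts : Set ℝ :=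
  {-1, -1 / 2, -1 / 4, 0, 1 / 4, 1 / 2}

/-- Every point of `C` has the numbers `1, 280, 1024, 1710, 1024, 280` of points of `C` at inner
products `-1, -1/2, -1/4, 0, 1/4, 1/2`. -/
def HasBarnesWallDistribution (C : Finset (EuclideanSpace ℝ (Fin 16))) : Prop :=
  ∀ x ∈ C, distanceCount C x (-1) = 1 ∧ distanceCount C x (-1 / 2) = 280 ∧
    distanceCount C x (-1 / 4) = 1024 ∧ distanceCount C x 0 = 1710 ∧
    distanceCount C x (1 / 4) = 1024 ∧ distanceCount C x (1 / 2) = 280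

/-- The value of the minimum energy. -/
def barnesWallBound (h : ℝ → ℝ) : ℝ :=
  4320 * (280 * (h (-1 / 2) + h (1 / 2)) + 1024 * (h (-1 / 4) + h (1 / 4)) + 1710 * h 0 + h (-1))

end

/-! The bound is a linear programming bound adapted to the gaps in `T`. Take as nodes the six inner
products of the Barnes–Wall code, one of them doubled, so that the degree 7 node polynomial is
nonnegative on [-1, 1) outside `T`: each gap is bounded by two adjacent simple nodes, -1 contributes
the factor t + 1, and the remaining node is squared. Let H be the Newton interpolant of h, of degree
at most 6. The error h - H is the node polynomial times a divided difference of order 7, which is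
nonnegative because the derivatives of h are, so h ≥ H on the inner products of any `T`-avoiding
code, with equality at the Barnes–Wall inner products.

The Newton coefficients of H after the constant one are nonnegative, so it suffices to bound the
energy of every partial product of the node factors. Each of these has nonnegative Gegenbauer
coefficients in positive degrees for dimension 16, and the Gegenbauer kernels of degrees 1 to 6 are
positive semidefinite (`sum_fischer_nonneg`). On polynomials of degree at most 6 the resulting lower
bound, N² times the spherical mean minus N times the value at 1, agrees with `barnesWallBound`
(`barnesWallBound_le_energy_of_coeff`).

Interpolation at -1 needs derivatives there, whereas h is only continuous at -1. The bound is
therefore proved for t ↦ h(ct) with 0 < c < 1, and c tends to 1.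

For equality, the six counts of inner products at a point solve a Vandermonde system given by the
moments of orders 0 to 5 (`hasBarnesWallDistribution_of_moments`). For a 7-design these moments are
those of the sphere, computed from invariance under isometries. For the Barnes–Wall code they come
from an explicit description of the minimal vectors: ±2 on two coordinates, or ±1 on an octad with
an even number of minus signs. Pairs and octads are both 2-designs, and in the fourth moment their
non-isotropic parts cancel (`sum_minimalIntVectors_pow_four`). -/

noncomputable section

/-! ### Newton interpolation of absolutely monotone functions -/

/-- A sequence of functions on the interval `(-r, r)`, each the derivative of the previous one and
all of them nonnegative. -/
structure IsMonotoneTower (r : ℝ) (f : ℕ → ℝ → ℝ) : Prop where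
  hasDerivAt : ∀ j, ∀ t ∈ Set.Ioo (-r) r, HasDerivAt (f j) (f (j + 1) t) t
  nonneg : ∀ j, ∀ t ∈ Set.Ioo (-r) r, 0 ≤ f j t

theorem segment_mem_Ioo {r a t s : ℝ} (ha : a ∈ Set.Ioo (-r) r) (ht : t ∈ Set.Ioo (-r) r)
    (hs : s ∈ Set.Icc (0 : ℝ) 1) : a + s * (t - a) ∈ Set.Ioo (-r) r := by
  have h := (convex_Ioo (-r) r) ha ht (sub_nonneg.2 hs.2) hs.1 (by ring)
  have e : (1 - s) • a + s • t = a + s * (t - a) := by simp only [smul_eq_mul]; ring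
  rwa [e] at h

/-- Differentiation under the integral sign; the chain rule supplies one more factor `s`. These
weighted means are thus closed under differentiation and yield all derivatives of a divided
difference at once. -/
theorem hasDerivAt_integral_pow_mul {r a : ℝ} {f g : ℝ → ℝ} (ha : a ∈ Set.Ioo (-r) r)
    (hf : ∀ t ∈ Set.Ioo (-r) r, HasDerivAt f (g t) t) (hg : ContinuousOn g (Set.Ioo (-r) r))
    (j : ℕ) {t : ℝ} (ht : t ∈ Set.Ioo (-r) r) :
    HasDerivAt (fun t => ∫ s in (0 : ℝ)..1, s ^ j * f (a + s * (t - a)))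
      (∫ s in (0 : ℝ)..1, s ^ (j + 1) * g (a + s * (t - a))) t := by
  have hfc : ContinuousOn f (Set.Ioo (-r) r) := fun t ht => (hf t ht).continuousAt.continuousWithinAt
  -- A compact interval [-l, l] containing `a` and `t` in its interior: `g` is bounded on it, which
  -- gives the dominating constant.
  obtain ⟨l, hl1, hl2⟩ := exists_between (max_lt (abs_lt.2 ha) (abs_lt.2 ht))
  have hla : |a| < l := (le_max_left _ _).trans_lt hl1
  have hlt : |t| < l := (le_max_right _ _).trans_lt hl1
  have hsub : Set.Icc (-l) l ⊆ Set.Ioo (-r) r := fun x hx =>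
    ⟨by linarith [hx.1], by linarith [hx.2]⟩
  obtain ⟨M, hM⟩ := isCompact_Icc.exists_bound_of_continuousOn (hg.mono hsub)
  have hcont : ∀ (φ : ℝ → ℝ), ContinuousOn φ (Set.Ioo (-r) r) → ∀ i : ℕ, ∀ x ∈ Set.Ioo (-l) l,
      ContinuousOn (fun s => s ^ i * φ (a + s * (x - a))) (Set.uIcc 0 1) := by
    intro φ hφ i x hx
    refine ContinuousOn.mul (by fun_prop) (hφ.comp (by fun_prop) fun s hs => ?_)
    rw [Set.uIcc_of_le zero_le_one] at hs
    exact segment_mem_Ioo ha (hsub ⟨hx.1.le, hx.2.le⟩) hs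
  have hnhds : Set.Ioo (-l) l ∈ nhds t := Ioo_mem_nhds (abs_lt.1 hlt).1 (abs_lt.1 hlt).2
  refine (intervalIntegral.hasDerivAt_integral_of_dominated_loc_of_deriv_le
    (F := fun t s => s ^ j * f (a + s * (t - a)))
    (F' := fun t s => s ^ (j + 1) * g (a + s * (t - a))) (bound := fun _ => M)
    (s := Set.Ioo (-l) l) hnhds ?_ ?_ ?_ ?_ ?_ ?_).2
  · filter_upwards [hnhds] with x hx
    exact (hcont f hfc j x hx).intervalIntegrable.aestronglyMeasurable_restrict_uIoc
  · exact (hcont f hfc j t (abs_lt.1 hlt)).intervalIntegrable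
  · exact (hcont g hg (j + 1) t (abs_lt.1 hlt)).intervalIntegrable.aestronglyMeasurable_restrict_uIoc
  · refine Filter.Eventually.of_forall fun s hs x hx => ?_
    rw [Set.uIoc_of_le zero_le_one] at hs
    have h1 : a + s * (x - a) ∈ Set.Icc (-l) l := by
      have := segment_mem_Ioo (abs_lt.1 hla) hx ⟨hs.1.le, hs.2⟩
      exact ⟨this.1.le, this.2.le⟩
    rw [norm_mul, norm_pow, Real.norm_of_nonneg hs.1.le]
    calc s ^ (j + 1) * ‖g (a + s * (x - a))‖ ≤ 1 * ‖g (a + s * (x - a))‖ := by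
          gcongr; exact pow_le_one₀ hs.1.le hs.2
      _ ≤ M := by rw [one_mul]; exact hM _ h1
  · exact intervalIntegrable_const
  · refine Filter.Eventually.of_forall fun s hs x hx => ?_
    rw [Set.uIoc_of_le zero_le_one] at hs
    have h1 : a + s * (x - a) ∈ Set.Ioo (-r) r :=
      segment_mem_Ioo ha (hsub ⟨hx.1.le, hx.2.le⟩) ⟨hs.1.le, hs.2⟩
    have h2 : HasDerivAt (fun x => a + s * (x - a)) s x := by
      simpa using (((hasDerivAt_id x).sub_const a).const_mul s).const_add a
    have := ((hf _ h1).comp x h2).const_mul (s ^ j)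
    rw [show s ^ (j + 1) * g (a + s * (x - a)) = s ^ j * (g (a + s * (x - a)) * s) by ring]
    exact this

/-- Divided differences of a function whose derivatives are nonnegative again have nonnegative
derivatives. -/
theorem exists_quotient_tower {r a : ℝ} {f : ℕ → ℝ → ℝ} (ha : a ∈ Set.Ioo (-r) r)
    (hf : ∀ j, ∀ t ∈ Set.Ioo (-r) r, HasDerivAt (f j) (f (j + 1) t) t)
    (hn : ∀ j, ∀ t ∈ Set.Ioo (-r) r, 0 ≤ f (j + 1) t) :
    ∃ q : ℕ → ℝ → ℝ, IsMonotoneTower r q ∧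
      ∀ t ∈ Set.Ioo (-r) r, f 0 t = f 0 a + (t - a) * q 0 t := by
  have hc : ∀ j, ContinuousOn (f j) (Set.Ioo (-r) r) := fun j t ht =>
    (hf j t ht).continuousAt.continuousWithinAt
  -- Hadamard's formula: (f(t) - f(a))/(t - a) is the mean of f' over the segment from a to t. It
  -- makes sense at t = a, so repeated nodes need no separate treatment.
  refine ⟨fun j t => ∫ s in (0 : ℝ)..1, s ^ j * f (j + 1) (a + s * (t - a)), ⟨?_, ?_⟩, ?_⟩
  · exact fun j t ht => hasDerivAt_integral_pow_mul ha (hf (j + 1)) (hc (j + 2)) j ht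
  · intro j t ht
    refine intervalIntegral.integral_nonneg zero_le_one fun s hs => ?_
    exact mul_nonneg (pow_nonneg hs.1 _) (hn j _ (segment_mem_Ioo ha ht hs))
  · intro t ht
    have h1 : ∀ s ∈ Set.uIcc (0 : ℝ) 1, HasDerivAt (fun s => f 0 (a + s * (t - a)))
        ((t - a) * f 1 (a + s * (t - a))) s := by
      intro s hs
      rw [Set.uIcc_of_le zero_le_one] at hs
      have h2 : HasDerivAt (fun s => a + s * (t - a)) (t - a) s := by
        simpa using ((hasDerivAt_id s).mul_const (t - a)).const_add a
      rw [mul_comm]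
      exact (hf 0 _ (segment_mem_Ioo ha ht hs)).comp s h2
    have h3 : ContinuousOn (fun s => (t - a) * f 1 (a + s * (t - a))) (Set.uIcc (0 : ℝ) 1) := by
      refine ContinuousOn.mul (by fun_prop) ((hc 1).comp (by fun_prop) fun s hs => ?_)
      rw [Set.uIcc_of_le zero_le_one] at hs
      exact segment_mem_Ioo ha ht hs
    have h4 := intervalIntegral.integral_eq_sub_of_hasDerivAt h1 h3.intervalIntegrable
    rw [intervalIntegral.integral_const_mul] at h4
    simp only [one_mul, zero_mul, add_zero, pow_zero, zero_add] at h4 ⊢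
    rw [h4]
    ring_nf

/-- Newton interpolation at seven nodes, with multiplicities, of a function with nonnegative
derivatives. -/
theorem exists_newton_interpolation {r : ℝ} {f : ℕ → ℝ → ℝ}
    (hf : ∀ j, ∀ t ∈ Set.Ioo (-r) r, HasDerivAt (f j) (f (j + 1) t) t)
    (hn : ∀ j, ∀ t ∈ Set.Ioo (-r) r, 0 ≤ f (j + 1) t) (a : Fin 7 → ℝ)
    (ha : ∀ i, a i ∈ Set.Ioo (-r) r) :
    ∃ (c : Fin 7 → ℝ) (q : ℝ → ℝ), (∀ i, i ≠ 0 → 0 ≤ c i) ∧ (∀ t ∈ Set.Ioo (-r) r, 0 ≤ q t) ∧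
      ∀ t ∈ Set.Ioo (-r) r, f 0 t = c 0 + c 1 * (t - a 0) + c 2 * ((t - a 0) * (t - a 1))
        + c 3 * ((t - a 0) * (t - a 1) * (t - a 2))
        + c 4 * ((t - a 0) * (t - a 1) * (t - a 2) * (t - a 3))
        + c 5 * ((t - a 0) * (t - a 1) * (t - a 2) * (t - a 3) * (t - a 4))
        + c 6 * ((t - a 0) * (t - a 1) * (t - a 2) * (t - a 3) * (t - a 4) * (t - a 5))
        + q t * ((t - a 0) * (t - a 1) * (t - a 2) * (t - a 3) * (t - a 4) * (t - a 5)
          * (t - a 6)) := by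
  -- Each quotient is divided again at the next node. Its value at that node is the next Newton
  -- coefficient, and the seventh quotient is the factor in the error term.
  obtain ⟨q1, h1, e1⟩ := exists_quotient_tower (ha 0) hf hn
  obtain ⟨q2, h2, e2⟩ := exists_quotient_tower (ha 1) h1.1 fun j => h1.2 _
  obtain ⟨q3, h3, e3⟩ := exists_quotient_tower (ha 2) h2.1 fun j => h2.2 _
  obtain ⟨q4, h4, e4⟩ := exists_quotient_tower (ha 3) h3.1 fun j => h3.2 _
  obtain ⟨q5, h5, e5⟩ := exists_quotient_tower (ha 4) h4.1 fun j => h4.2 _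
  obtain ⟨q6, h6, e6⟩ := exists_quotient_tower (ha 5) h5.1 fun j => h5.2 _
  obtain ⟨q7, h7, e7⟩ := exists_quotient_tower (ha 6) h6.1 fun j => h6.2 _
  refine ⟨![f 0 (a 0), q1 0 (a 1), q2 0 (a 2), q3 0 (a 3), q4 0 (a 4), q5 0 (a 5), q6 0 (a 6)],
    q7 0, ?_, h7.2 0, fun t ht => ?_⟩
  · intro i hi
    fin_cases i
    · exact absurd rfl hi
    · exact h1.2 0 _ (ha 1)
    · exact h2.2 0 _ (ha 2)
    · exact h3.2 0 _ (ha 3)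
    · exact h4.2 0 _ (ha 4)
    · exact h5.2 0 _ (ha 5)
    · exact h6.2 0 _ (ha 6)
  · rw [e1 t ht, e2 t ht, e3 t ht, e4 t ht, e5 t ht, e6 t ht, e7 t ht]
    simp only [Matrix.cons_val]
    ring

theorem IsAbsolutelyMonotone.hasDerivAt {h : ℝ → ℝ} (hh : IsAbsolutelyMonotone h) (j : ℕ) {t : ℝ}
    (ht : t ∈ Set.Ioo (-1 : ℝ) 1) :
    HasDerivAt (iteratedDeriv j h) (iteratedDeriv (j + 1) h t) t := by
  have h1 := hh.2.1.differentiableOn_iteratedDerivWithin (m := j)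
    (by exact_mod_cast WithTop.coe_lt_top _) isOpen_Ioo.uniqueDiffOn
  have h2 : DifferentiableAt ℝ (iteratedDeriv j h) t :=
    ((h1.congr fun x hx => (iteratedDerivWithin_of_isOpen isOpen_Ioo hx).symm) t ht).differentiableAt
      (isOpen_Ioo.mem_nhds ht)
  rw [iteratedDeriv_succ]
  exact h2.hasDerivAt

/-! ### The Fischer inner product and positivity of Gegenbauer kernels -/

namespace MvPolynomial

variable {n : ℕ}

theorem sum_support_eq_of_subset {p : MvPolynomial (Fin n) ℝ} {s : Finset (Fin n →₀ ℕ)}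
    (hs : p.support ⊆ s) (w : (Fin n →₀ ℕ) → ℝ) (q : MvPolynomial (Fin n) ℝ) :
    ∑ α ∈ p.support, w α * coeff α p * coeff α q = ∑ α ∈ s, w α * coeff α p * coeff α q :=
  Finset.sum_subset hs fun α _ h => by simp [notMem_support_iff.1 h]

/-- The Fischer (apolar) inner product on polynomials. -/
def fischer : MvPolynomial (Fin n) ℝ →ₗ[ℝ] MvPolynomial (Fin n) ℝ →ₗ[ℝ] ℝ :=
  LinearMap.mk₂ ℝ
    (fun p q => ∑ α ∈ p.support, (∏ i, ((α i).factorial : ℝ)) * coeff α p * coeff α q)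
    (fun p p' q => by
      classical
      rw [sum_support_eq_of_subset support_add,
        sum_support_eq_of_subset (p := p) (Finset.subset_union_left (s₂ := p'.support)),
        sum_support_eq_of_subset (p := p') (Finset.subset_union_right (s₁ := p.support)), ← Finset.sum_add_distrib]
      exact Finset.sum_congr rfl fun α _ => by rw [coeff_add]; ring)
    (fun c p q => by
      rw [sum_support_eq_of_subset support_smul, smul_eq_mul, Finset.mul_sum]
      exact Finset.sum_congr rfl fun α _ => by rw [coeff_smul, smul_eq_mul]; ring)
    (fun p q q' => by
      rw [← Finset.sum_add_distrib]
      exact Finset.sum_congr rfl fun α _ => by rw [coeff_add]; ring)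
    (fun c p q => by
      rw [smul_eq_mul, Finset.mul_sum]
      exact Finset.sum_congr rfl fun α _ => by rw [coeff_smul, smul_eq_mul]; ring)

theorem fischer_apply (p q : MvPolynomial (Fin n) ℝ) :
    fischer p q = ∑ α ∈ p.support, (∏ i, ((α i).factorial : ℝ)) * coeff α p * coeff α q := rfl

theorem fischer_symm (p q : MvPolynomial (Fin n) ℝ) : fischer p q = fischer q p := by
  classical
  have key : ∀ p q : MvPolynomial (Fin n) ℝ, fischer p q =
      ∑ α ∈ p.support ∪ q.support, (∏ i, ((α i).factorial : ℝ)) * coeff α p * coeff α q := by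
    intro p q
    exact sum_support_eq_of_subset Finset.subset_union_left _ _
  rw [key p q, key q p, Finset.union_comm]
  exact Finset.sum_congr rfl fun _ _ => by ring

theorem fischer_self_nonneg (p : MvPolynomial (Fin n) ℝ) : 0 ≤ fischer p p := by
  rw [fischer_apply]
  refine Finset.sum_nonneg fun α _ => ?_
  rw [mul_assoc]
  exact mul_nonneg (by positivity) (mul_self_nonneg _)

/-- The weights α! are chosen for this adjointness: (α + eᵢ)! = (αᵢ + 1) α!, which is the factor
produced by ∂ᵢ. Consequently `normSqForm` is adjoint to the Laplacian. -/
theorem fischer_X_mul (i : Fin n) (p q : MvPolynomial (Fin n) ℝ) :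
    fischer (X i * p) q = fischer p (pderiv i q) := by
  rw [fischer_apply, fischer_apply, support_X_mul, Finset.sum_map]
  refine Finset.sum_congr rfl fun α _ => ?_
  have h1 : (∏ j, (((Finsupp.single i 1 + α : Fin n →₀ ℕ) j).factorial : ℝ))
      = (α i + 1) * ∏ j, ((α j).factorial : ℝ) := by
    rw [← Finset.mul_prod_erase _ _ (Finset.mem_univ i),
      ← Finset.mul_prod_erase (a := i) _ (fun j => ((α j).factorial : ℝ)) (Finset.mem_univ i),
      Finset.prod_congr rfl (g := fun j => ((α j).factorial : ℝ))]
    · simp [add_comm 1 (α i), Nat.factorial_succ, mul_assoc]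
    · intro j hj
      simp [Finset.ne_of_mem_erase hj]
  simp only [addLeftEmbedding_apply, coeff_X_mul, coeff_pderiv]
  rw [h1, add_comm (Finsupp.single i 1) α]
  ring

/-- The linear form `∑ xᵢ Xᵢ`. -/
def linForm (x : Fin n → ℝ) : MvPolynomial (Fin n) ℝ := ∑ i, C (x i) * X i

/-- The quadratic form `∑ Xᵢ²`. -/
def normSqForm (n : ℕ) : MvPolynomial (Fin n) ℝ := ∑ i, X i ^ 2

/-- The Laplace operator on polynomials. -/
def lap : MvPolynomial (Fin n) ℝ →ₗ[ℝ] MvPolynomial (Fin n) ℝ :=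
  ∑ i, (pderiv i).toLinearMap ∘ₗ (pderiv i).toLinearMap

/-- The Euler derivation `∑ Xᵢ ∂ᵢ`. -/
def euler : Derivation ℝ (MvPolynomial (Fin n) ℝ) (MvPolynomial (Fin n) ℝ) :=
  ∑ i : Fin n, (X i : MvPolynomial (Fin n) ℝ) • pderiv (R := ℝ) i

theorem lap_apply (p : MvPolynomial (Fin n) ℝ) : lap p = ∑ i, pderiv i (pderiv i p) := by
  simp [lap, LinearMap.sum_apply]

theorem euler_apply (p : MvPolynomial (Fin n) ℝ) : euler p = ∑ i, X i * pderiv i p := by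
  simp only [euler]
  rw [← Derivation.coeFnAddMonoidHom_apply, map_sum]
  simp

theorem pderiv_linForm (i : Fin n) (x : Fin n → ℝ) : pderiv i (linForm x) = C (x i) := by
  classical
  simp [linForm, pderiv_X, Pi.single_apply]

theorem pderiv_normSqForm (i : Fin n) : pderiv i (normSqForm n) = 2 * X i := by
  classical
  simp [normSqForm, pderiv_X, Pi.single_apply]

theorem euler_linForm (x : Fin n → ℝ) : euler (linForm x) = linForm x := by
  simp only [euler_apply, pderiv_linForm, mul_comm (X _)]
  rfl

theorem euler_normSqForm : euler (normSqForm n) = 2 * normSqForm n := by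
  simp only [euler_apply, pderiv_normSqForm]
  rw [normSqForm, Finset.mul_sum]
  exact Finset.sum_congr rfl fun i _ => by ring

theorem lap_normSqForm_mul (p : MvPolynomial (Fin n) ℝ) :
    lap (normSqForm n * p) = 2 * (n : MvPolynomial (Fin n) ℝ) * p + 4 * euler p
      + normSqForm n * lap p := by
  have h : ∀ i, pderiv i (pderiv i (normSqForm n * p)) =
      2 * p + 4 * (X i * pderiv i p) + normSqForm n * pderiv i (pderiv i p) := by
    intro i
    have h2 : pderiv i (2 : MvPolynomial (Fin n) ℝ) = 0 := by
      rw [← map_ofNat C, pderiv_C]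
    rw [pderiv_mul, pderiv_normSqForm, map_add, pderiv_mul, pderiv_mul, pderiv_mul,
      pderiv_normSqForm, pderiv_X_self, h2]
    ring
  rw [lap_apply, lap_apply, euler_apply, Finset.sum_congr rfl fun i _ => h i,
    Finset.sum_add_distrib, Finset.sum_add_distrib, Finset.mul_sum, Finset.mul_sum]
  simp only [Finset.sum_const, Finset.card_univ, Fintype.card_fin, nsmul_eq_mul]
  ring

theorem lap_linForm_pow {x : Fin n → ℝ} (hx : ∑ i, x i ^ 2 = 1) (m : ℕ) :
    lap (linForm x ^ (m + 2)) = ((m + 2) * (m + 1) : ℝ) • linForm x ^ m := by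
  have h : ∀ i, pderiv i (pderiv i (linForm x ^ (m + 2))) =
      ((m + 2) * (m + 1) : ℝ) • (C (x i ^ 2) * linForm x ^ m) := by
    intro i
    rw [pderiv_pow, pderiv_linForm, mul_comm _ (C (x i)), pderiv_C_mul, pderiv_mul]
    have h2 : pderiv i (((m + 2 : ℕ)) : MvPolynomial (Fin n) ℝ) = 0 := by
      rw [← map_natCast C, pderiv_C]
    rw [h2, Nat.add_succ_sub_one, pderiv_pow, pderiv_linForm, smul_eq_C_mul]
    simp only [map_mul, map_add, map_pow, map_natCast, map_one, map_ofNat, Nat.cast_add,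
      Nat.cast_one, Nat.cast_ofNat, Nat.add_sub_cancel]
    ring
  rw [lap_apply, Finset.sum_congr rfl fun i _ => h i, ← Finset.smul_sum, ← Finset.sum_mul,
    ← map_sum, hx]
  simp

theorem lap_linForm (x : Fin n → ℝ) : lap (linForm x) = 0 := by
  simp [lap_apply, pderiv_linForm]

theorem lap_one : lap (1 : MvPolynomial (Fin n) ℝ) = 0 := by
  simp [lap_apply]

theorem fischer_normSqForm_mul (p q : MvPolynomial (Fin n) ℝ) :
    fischer (normSqForm n * p) q = fischer p (lap q) := by
  rw [normSqForm, Finset.sum_mul, map_sum, LinearMap.sum_apply, lap_apply, map_sum]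
  refine Finset.sum_congr rfl fun i _ => ?_
  rw [sq, mul_assoc, fischer_X_mul, fischer_X_mul]

theorem fischer_linForm_mul (x : Fin n → ℝ) (p q : MvPolynomial (Fin n) ℝ) :
    fischer (linForm x * p) q = fischer p (∑ i, x i • pderiv i q) := by
  rw [linForm, Finset.sum_mul, map_sum, LinearMap.sum_apply, map_sum]
  refine Finset.sum_congr rfl fun i _ => ?_
  rw [mul_assoc, ← smul_eq_C_mul, map_smul, LinearMap.smul_apply, fischer_X_mul, map_smul]

/-- Multiplication by ℓ_y is adjoint to the derivative along y, which lowers a power of ℓ_x.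
Together with `fischer_pow_normSqForm_mul` this evaluates ⟨ℓ_xᵐ, ρʲ ℓ_yᵐ⁻²ʲ⟩ = m! (x·y)ᵐ⁻²ʲ for unit
x, with ρ = ∑ Xᵢ². -/
theorem fischer_pow_linForm_mul (x y : Fin n → ℝ) (k : ℕ) (q : MvPolynomial (Fin n) ℝ) :
    fischer (linForm x ^ (k + 1)) (linForm y * q)
      = (k + 1) * (∑ i, x i * y i) * fischer (linForm x ^ k) q := by
  have h : ∑ i, y i • pderiv i (linForm x ^ (k + 1))
      = ((k + 1 : ℝ) * ∑ i, x i * y i) • linForm x ^ k := by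
    simp only [pderiv_pow, pderiv_linForm, Nat.add_sub_cancel, Finset.mul_sum, Finset.sum_smul]
    refine Finset.sum_congr rfl fun i _ => ?_
    simp only [smul_eq_C_mul, map_mul, map_add, map_natCast, map_one, Nat.cast_add, Nat.cast_one]
    ring
  rw [fischer_symm, fischer_linForm_mul, h, map_smul, smul_eq_mul, fischer_symm]

theorem fischer_pow_normSqForm_mul {x : Fin n → ℝ} (hx : ∑ i, x i ^ 2 = 1) (k : ℕ)
    (q : MvPolynomial (Fin n) ℝ) :
    fischer (linForm x ^ (k + 2)) (normSqForm n * q)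
      = (k + 2) * (k + 1) * fischer (linForm x ^ k) q := by
  rw [fischer_symm, fischer_normSqForm_mul, lap_linForm_pow hx, map_smul, smul_eq_mul, fischer_symm]

theorem fischer_one_one : fischer (1 : MvPolynomial (Fin n) ℝ) 1 = 1 := by
  rw [fischer_apply]
  have : (1 : MvPolynomial (Fin n) ℝ).support = {0} := by
    have := support_monomial (R := ℝ) (s := (0 : Fin n →₀ ℕ)) (a := 1)
    simp
  simp [this]

/-- If `Φ x = c ℓₓᵏ + ρ Ψ x` is harmonic for all points of a family, the kernel
`⟨ℓₓᵏ, Φ y⟩` is positive semidefinite. -/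
theorem sum_fischer_nonneg {ι : Type*} (s : Finset ι) (Φ Ψ L : ι → MvPolynomial (Fin n) ℝ) {c : ℝ}
    (hc : 0 < c) (h : ∀ x ∈ s, Φ x = c • L x + normSqForm n * Ψ x)
    (hl : ∀ x ∈ s, lap (Φ x) = 0) : 0 ≤ ∑ x ∈ s, ∑ y ∈ s, fischer (L x) (Φ y) := by
  -- The squared Fischer norm of ∑ Φ x is expanded as a double sum. In each term the part of Φ x
  -- divisible by ρ pairs to zero with the harmonic Φ y.
  have h1 := fischer_self_nonneg (∑ x ∈ s, Φ x)
  simp only [map_sum, LinearMap.sum_apply] at h1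
  rw [Finset.sum_comm] at h1
  have h2 : ∀ x ∈ s, ∀ y ∈ s, fischer (Φ x) (Φ y) = c * fischer (L x) (Φ y) := by
    intro x hx y hy
    rw [h x hx, map_add, LinearMap.add_apply, fischer_normSqForm_mul, hl y hy, map_zero, add_zero,
      map_smul, LinearMap.smul_apply, smul_eq_mul]
  rw [Finset.sum_congr rfl fun x hx => Finset.sum_congr rfl fun y hy => h2 x hx y hy] at h1
  simp only [← Finset.mul_sum] at h1
  exact nonneg_of_mul_nonneg_right h1 hc

end MvPolynomial

/-! ### Power sums of inner products -/

/-- The sum of the `k`-th powers of all inner products of points of `C`. -/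
def powerSum {n : ℕ} (C : Finset (EuclideanSpace ℝ (Fin n))) (k : ℕ) : ℝ :=
  ∑ x ∈ C, ∑ y ∈ C, (inner ℝ x y : ℝ) ^ k

theorem EuclideanSpace.sum_sq_eq_one {n : ℕ} {x : EuclideanSpace ℝ (Fin n)} (hx : ‖x‖ = 1) :
    ∑ i, x i ^ 2 = 1 := by
  have := EuclideanSpace.real_norm_sq_eq x
  rw [hx] at this
  linarith

theorem EuclideanSpace.inner_eq_sum_mul {n : ℕ} (x y : EuclideanSpace ℝ (Fin n)) :
    (inner ℝ x y : ℝ) = ∑ i, x i * y i := by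
  rw [PiLp.inner_apply]
  exact Finset.sum_congr rfl fun i _ => by simp [mul_comm]

namespace MvPolynomial

/-- The linear form of a point of Euclidean space. -/
abbrev pointForm {n : ℕ} (x : EuclideanSpace ℝ (Fin n)) : MvPolynomial (Fin n) ℝ :=
  linForm fun i => x i

variable {n : ℕ} {x y : EuclideanSpace ℝ (Fin n)}

theorem fischer_pointForm_succ (k : ℕ) (q : MvPolynomial (Fin n) ℝ) :
    fischer (pointForm x ^ (k + 1)) (pointForm y * q)
      = (k + 1) * inner ℝ x y * fischer (pointForm x ^ k) q := by
  rw [EuclideanSpace.inner_eq_sum_mul, fischer_pow_linForm_mul]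

theorem fischer_pointForm_normSq (hx : ‖x‖ = 1) (k : ℕ) (q : MvPolynomial (Fin n) ℝ) :
    fischer (pointForm x ^ (k + 2)) (normSqForm n * q)
      = (k + 2) * (k + 1) * fischer (pointForm x ^ k) q :=
  fischer_pow_normSqForm_mul (EuclideanSpace.sum_sq_eq_one hx) k q

theorem fischer_pointForm_pow (m : ℕ) :
    fischer (pointForm x ^ m) (pointForm y ^ m) = m.factorial * (inner ℝ x y : ℝ) ^ m := by
  induction m with
  | zero => simpa using fischer_one_one
  | succ m ih =>
    rw [pow_succ' (pointForm y), fischer_pointForm_succ, ih, Nat.factorial_succ]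
    push_cast
    ring

theorem lap_pointForm_pow (hx : ‖x‖ = 1) (m : ℕ) :
    lap (pointForm x ^ (m + 2)) = ((m + 2) * (m + 1) : ℝ) • pointForm x ^ m :=
  lap_linForm_pow (EuclideanSpace.sum_sq_eq_one hx) m

theorem euler_pointForm_pow (m : ℕ) : euler (pointForm x ^ m) = (m : ℝ) • pointForm x ^ m := by
  cases m with
  | zero => simp
  | succ m =>
    rw [Derivation.leibniz_pow, euler_linForm, Nat.add_sub_cancel, smul_eq_mul, ← pow_succ,
      Nat.cast_smul_eq_nsmul]

theorem euler_normSqForm_mul (p : MvPolynomial (Fin n) ℝ) :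
    euler (normSqForm n * p) = normSqForm n * (2 * p + euler p) := by
  rw [Derivation.leibniz, euler_normSqForm, smul_eq_mul, smul_eq_mul]
  ring

theorem lap_pointForm_pow_zero : lap (pointForm x ^ 0) = 0 := by
  rw [pow_zero, lap_one]

theorem lap_pointForm_pow_one : lap (pointForm x ^ 1) = 0 := by
  rw [pow_one, lap_linForm]

end MvPolynomial

open MvPolynomial

variable {C : Finset (EuclideanSpace ℝ (Fin 16))}

/-- Here Φ x is a zonal harmonic of degree m with pole x, and g is a positive multiple of the
Gegenbauer polynomial of degree m in dimension 16. -/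
theorem powerSum_nonneg_of_harmonic (hC : IsSphericalCode C) (m : ℕ)
    (Φ Ψ : EuclideanSpace ℝ (Fin 16) → MvPolynomial (Fin 16) ℝ) {c : ℝ} (hc : 0 < c)
    (h : ∀ x, Φ x = c • pointForm x ^ m + normSqForm 16 * Ψ x)
    (hl : ∀ x, ‖x‖ = 1 → lap (Φ x) = 0) (g : ℝ → ℝ)
    (hg : ∀ x y, ‖x‖ = 1 → fischer (pointForm x ^ m) (Φ y) = m.factorial * g (inner ℝ x y)) :
    0 ≤ ∑ x ∈ C, ∑ y ∈ C, g (inner ℝ x y) := by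
  have := sum_fischer_nonneg C Φ Ψ (fun x => pointForm x ^ m) hc (fun x _ => h x)
    (fun x hx => hl x (hC x hx))
  rw [Finset.sum_congr rfl fun x hx => Finset.sum_congr rfl fun y _ => hg x y (hC x hx)] at this
  simp only [← Finset.mul_sum] at this
  exact nonneg_of_mul_nonneg_right this (by positivity)

/-! ### Gegenbauer inequalities of degrees 1 to 6 in dimension 16 -/

theorem powerSum_one_nonneg (hC : IsSphericalCode C) : 0 ≤ powerSum C 1 := by
  have := powerSum_nonneg_of_harmonic hC 1 (fun x => (1 : ℝ) • pointForm x ^ 1) 0 one_pos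
    (fun x => by simp) (fun x _ => by simp [lap_linForm]) (fun t => t ^ 1)
    (fun x y hx => by rw [one_smul, fischer_pointForm_pow])
  exact this

/-- 16t² - 1 is the Gegenbauer polynomial up to scale. In this and the next four degrees, Φ x is
obtained by homogenizing: t^(m-2j) becomes ρʲ ℓ_x^(m-2j), and the coefficients are exactly those for
which the Laplacian vanishes. -/
theorem powerSum_two_nonneg (hC : IsSphericalCode C) :
    0 ≤ 16 * powerSum C 2 - powerSum C 0 := by
  have := powerSum_nonneg_of_harmonic hC 2
    (fun x => (16 : ℝ) • pointForm x ^ 2 + normSqForm 16 * ((-1 : ℝ) • pointForm x ^ 0)) _ (by norm_num)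
    (fun x => rfl) (fun x hx => by
      simp only [map_add, map_smul, Derivation.map_smul, lap_normSqForm_mul, lap_pointForm_pow hx 0,
        lap_pointForm_pow_zero, euler_pointForm_pow]
      simp only [smul_eq_C_mul, map_ofNat, map_neg, map_one, map_mul, map_add, map_natCast]
      push_cast
      ring)
    (fun t => 16 * t ^ 2 - t ^ 0)
    (fun x y hx => by
      simp only [map_add, map_smul, fischer_pointForm_normSq hx 0, fischer_pointForm_pow,
        mul_add, smul_eq_mul, Nat.factorial]
      push_cast
      ring)
  simpa only [powerSum, Finset.sum_sub_distrib, Finset.sum_add_distrib, Finset.mul_sum] using this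

theorem powerSum_three_nonneg (hC : IsSphericalCode C) :
    0 ≤ 6 * powerSum C 3 - powerSum C 1 := by
  have := powerSum_nonneg_of_harmonic hC 3
    (fun x => (6 : ℝ) • pointForm x ^ 3 + normSqForm 16 * ((-1 : ℝ) • pointForm x ^ 1)) _ (by norm_num)
    (fun x => rfl) (fun x hx => by
      simp only [map_add, map_smul, Derivation.map_smul, lap_normSqForm_mul, lap_pointForm_pow hx 1,
        lap_pointForm_pow_one, euler_pointForm_pow]
      simp only [smul_eq_C_mul, map_ofNat, map_neg, map_one, map_mul, map_add, map_natCast]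
      push_cast
      ring)
    (fun t => 6 * t ^ 3 - t ^ 1)
    (fun x y hx => by
      simp only [map_add, map_smul, fischer_pointForm_normSq hx 1, fischer_pointForm_pow,
        mul_add, smul_eq_mul, Nat.factorial]
      push_cast
      ring)
  simpa only [powerSum, Finset.sum_sub_distrib, Finset.sum_add_distrib, Finset.mul_sum] using this

theorem powerSum_four_nonneg (hC : IsSphericalCode C) :
    0 ≤ 120 * powerSum C 4 - 36 * powerSum C 2 + powerSum C 0 := by
  have := powerSum_nonneg_of_harmonic hC 4
    (fun x => (120 : ℝ) • pointForm x ^ 4 + normSqForm 16 * ((-36 : ℝ) • pointForm x ^ 2 + normSqForm 16 * ((1 : ℝ) • pointForm x ^ 0))) _ (by norm_num)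
    (fun x => rfl) (fun x hx => by
      simp only [map_add, map_smul, Derivation.map_smul, lap_normSqForm_mul, lap_pointForm_pow hx 2, lap_pointForm_pow hx 0,
        lap_pointForm_pow_zero, euler_normSqForm_mul, euler_pointForm_pow]
      simp only [smul_eq_C_mul, map_ofNat, map_neg, map_one, map_mul, map_add, map_natCast]
      push_cast
      ring)
    (fun t => 120 * t ^ 4 - 36 * t ^ 2 + t ^ 0)
    (fun x y hx => by
      simp only [map_add, map_smul, fischer_pointForm_normSq hx 2, fischer_pointForm_normSq hx 0, fischer_pointForm_pow,
        mul_add, smul_eq_mul, Nat.factorial]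
      push_cast
      ring)
  simpa only [powerSum, Finset.sum_sub_distrib, Finset.sum_add_distrib, Finset.mul_sum] using this

theorem powerSum_five_nonneg (hC : IsSphericalCode C) :
    0 ≤ 88 * powerSum C 5 - 40 * powerSum C 3 + 3 * powerSum C 1 := by
  have := powerSum_nonneg_of_harmonic hC 5
    (fun x => (88 : ℝ) • pointForm x ^ 5 + normSqForm 16 * ((-40 : ℝ) • pointForm x ^ 3 + normSqForm 16 * ((3 : ℝ) • pointForm x ^ 1))) _ (by norm_num)
    (fun x => rfl) (fun x hx => by
      simp only [map_add, map_smul, Derivation.map_smul, lap_normSqForm_mul, lap_pointForm_pow hx 3, lap_pointForm_pow hx 1,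
        lap_pointForm_pow_one, euler_normSqForm_mul, euler_pointForm_pow]
      simp only [smul_eq_C_mul, map_ofNat, map_neg, map_one, map_mul, map_add, map_natCast]
      push_cast
      ring)
    (fun t => 88 * t ^ 5 - 40 * t ^ 3 + 3 * t ^ 1)
    (fun x y hx => by
      simp only [map_add, map_smul, fischer_pointForm_normSq hx 3, fischer_pointForm_normSq hx 1, fischer_pointForm_pow,
        mul_add, smul_eq_mul, Nat.factorial]
      push_cast
      ring)
  simpa only [powerSum, Finset.sum_sub_distrib, Finset.sum_add_distrib, Finset.mul_sum] using this

theorem powerSum_six_nonneg (hC : IsSphericalCode C) :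
    0 ≤ 704 * powerSum C 6 - 440 * powerSum C 4 + 60 * powerSum C 2 - powerSum C 0 := by
  have := powerSum_nonneg_of_harmonic hC 6
    (fun x => (704 : ℝ) • pointForm x ^ 6 + normSqForm 16 * ((-440 : ℝ) • pointForm x ^ 4 + normSqForm 16 * ((60 : ℝ) • pointForm x ^ 2 + normSqForm 16 * ((-1 : ℝ) • pointForm x ^ 0)))) _ (by norm_num)
    (fun x => rfl) (fun x hx => by
      simp only [map_add, map_smul, Derivation.map_smul, lap_normSqForm_mul, lap_pointForm_pow hx 4, lap_pointForm_pow hx 2, lap_pointForm_pow hx 0,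
        lap_pointForm_pow_zero, euler_normSqForm_mul, euler_pointForm_pow]
      simp only [smul_eq_C_mul, map_ofNat, map_neg, map_one, map_mul, map_add, map_natCast]
      push_cast
      ring)
    (fun t => 704 * t ^ 6 - 440 * t ^ 4 + 60 * t ^ 2 - t ^ 0)
    (fun x y hx => by
      simp only [map_add, map_smul, fischer_pointForm_normSq hx 4, fischer_pointForm_normSq hx 2, fischer_pointForm_normSq hx 0, fischer_pointForm_pow,
        mul_add, smul_eq_mul, Nat.factorial]
      push_cast
      ring)
  simpa only [powerSum, Finset.sum_sub_distrib, Finset.sum_add_distrib, Finset.mul_sum] using this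

/-! ### Linear programming bound -/

theorem energy_congr {n : ℕ} {C : Finset (EuclideanSpace ℝ (Fin n))} {f g : ℝ → ℝ}
    (h : ∀ t ∈ innerProducts C, f t = g t) : energy f C = energy g C := by
  refine Finset.sum_congr rfl fun p hp => h _ ?_
  rw [Finset.mem_offDiag] at hp
  exact ⟨p.1, hp.1, p.2, hp.2.1, hp.2.2, rfl⟩

theorem energy_mono {n : ℕ} {C : Finset (EuclideanSpace ℝ (Fin n))} {f g : ℝ → ℝ}
    (h : ∀ t ∈ innerProducts C, f t ≤ g t) : energy f C ≤ energy g C := by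
  refine Finset.sum_le_sum fun p hp => h _ ?_
  rw [Finset.mem_offDiag] at hp
  exact ⟨p.1, hp.1, p.2, hp.2.1, hp.2.2, rfl⟩

theorem energy_add {n : ℕ} (C : Finset (EuclideanSpace ℝ (Fin n))) (f g : ℝ → ℝ) :
    energy (fun t => f t + g t) C = energy f C + energy g C :=
  Finset.sum_add_distrib

theorem energy_const_mul {n : ℕ} (C : Finset (EuclideanSpace ℝ (Fin n))) (c : ℝ) (f : ℝ → ℝ) :
    energy (fun t => c * f t) C = c * energy f C :=
  (Finset.mul_sum _ _ _).symm

theorem energy_eq_sum_sub {n : ℕ} {C : Finset (EuclideanSpace ℝ (Fin n))} (hC : IsSphericalCode C)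
    (f : ℝ → ℝ) :
    energy f C = (∑ x ∈ C, ∑ y ∈ C, f (inner ℝ x y)) - C.card * f 1 := by
  classical
  have h1 : ∑ p ∈ C.diag, f (inner ℝ p.1 p.2) = C.card * f 1 := by
    rw [Finset.sum_diag, Finset.sum_congr rfl (g := fun _ => f 1)]
    · simp
    · intro x hx
      rw [real_inner_self_eq_norm_sq, hC x hx, one_pow]
  rw [← h1, ← Finset.sum_product', ← Finset.diag_union_offDiag,
    Finset.sum_union (Finset.disjoint_diag_offDiag C), add_sub_cancel_left]
  unfold energy
  congr!

theorem energy_pow {n : ℕ} {C : Finset (EuclideanSpace ℝ (Fin n))} (hC : IsSphericalCode C)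
    (k : ℕ) : energy (fun t => t ^ k) C = powerSum C k - C.card := by
  rw [energy_eq_sum_sub hC, one_pow, mul_one]
  rfl

theorem innerProducts_subset_Ico {n : ℕ} {C : Finset (EuclideanSpace ℝ (Fin n))}
    (hC : IsSphericalCode C) : innerProducts C ⊆ Set.Ico (-1) 1 := by
  rintro t ⟨x, hx, y, hy, hxy, rfl⟩
  refine ⟨?_, (inner_lt_one_iff_real_of_norm_eq_one (hC x hx) (hC y hy)).2 hxy⟩
  have := abs_real_inner_le_norm x y
  rw [hC x hx, hC y hy, one_mul] at this
  exact (abs_le.1 this).1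

/-- The numbers 270, 45 and 45/4 are 4320 times the spherical means 1/16, 1/96 and 1/384 of t², t⁴
and t⁶. The Barnes–Wall distribution, with the point itself added at t = 1, has these same moments
and vanishing odd ones, so `hb` is the assertion after the diagonal has been restored. -/
theorem barnesWallBound_le_energy_of_coeff (hC : IsSphericalCode C) (hN : C.card = 4320)
    {g : ℝ → ℝ} {b : Fin 7 → ℝ}
    (hg : ∀ t, g t = b 0 * t ^ 0 + b 1 * t ^ 1 + b 2 * t ^ 2 + b 3 * t ^ 3 + b 4 * t ^ 4
      + b 5 * t ^ 5 + b 6 * t ^ 6)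
    (hb : 4320 * (4320 * b 0 + 270 * b 2 + 45 * b 4 + 45 / 4 * b 6)
      ≤ b 0 * powerSum C 0 + b 1 * powerSum C 1 + b 2 * powerSum C 2 + b 3 * powerSum C 3
        + b 4 * powerSum C 4 + b 5 * powerSum C 5 + b 6 * powerSum C 6) :
    barnesWallBound g ≤ energy g C := by
  have h : energy g C = b 0 * (powerSum C 0 - 4320) + b 1 * (powerSum C 1 - 4320)
      + b 2 * (powerSum C 2 - 4320) + b 3 * (powerSum C 3 - 4320) + b 4 * (powerSum C 4 - 4320)
      + b 5 * (powerSum C 5 - 4320) + b 6 * (powerSum C 6 - 4320) := by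
    have hc : (4320 : ℝ) = C.card := by rw [hN]; norm_num
    rw [energy_congr fun t _ => hg t, hc]
    simp only [energy_add, energy_const_mul, energy_pow hC]
  rw [h]
  simp only [barnesWallBound, hg]
  linarith

theorem powerSum_facts (hC : IsSphericalCode C) (hN : C.card = 4320) :
    powerSum C 0 = 4320 ^ 2 ∧ 0 ≤ powerSum C 1 ∧ 0 ≤ 16 * powerSum C 2 - powerSum C 0 ∧
      0 ≤ 6 * powerSum C 3 - powerSum C 1 ∧
      0 ≤ 120 * powerSum C 4 - 36 * powerSum C 2 + powerSum C 0 ∧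
      0 ≤ 88 * powerSum C 5 - 40 * powerSum C 3 + 3 * powerSum C 1 ∧
      0 ≤ 704 * powerSum C 6 - 440 * powerSum C 4 + 60 * powerSum C 2 - powerSum C 0 :=
  ⟨by simp [powerSum, hN]; norm_num, powerSum_one_nonneg hC, powerSum_two_nonneg hC,
    powerSum_three_nonneg hC, powerSum_four_nonneg hC, powerSum_five_nonneg hC,
    powerSum_six_nonneg hC⟩

/-- Each partial product of the nodes obeys the energy bound on every code of `4320` points. -/
def HasPositiveNewtonBasis (a : Fin 7 → ℝ) : Prop :=
  ∀ C : Finset (EuclideanSpace ℝ (Fin 16)), IsSphericalCode C → C.card = 4320 →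
    barnesWallBound (fun t => t - a 0) ≤ energy (fun t => t - a 0) C ∧
    barnesWallBound (fun t => (t - a 0) * (t - a 1))
      ≤ energy (fun t => (t - a 0) * (t - a 1)) C ∧
    barnesWallBound (fun t => (t - a 0) * (t - a 1) * (t - a 2))
      ≤ energy (fun t => (t - a 0) * (t - a 1) * (t - a 2)) C ∧
    barnesWallBound (fun t => (t - a 0) * (t - a 1) * (t - a 2) * (t - a 3))
      ≤ energy (fun t => (t - a 0) * (t - a 1) * (t - a 2) * (t - a 3)) C ∧
    barnesWallBound (fun t => (t - a 0) * (t - a 1) * (t - a 2) * (t - a 3) * (t - a 4))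
      ≤ energy (fun t => (t - a 0) * (t - a 1) * (t - a 2) * (t - a 3) * (t - a 4)) C ∧
    barnesWallBound (fun t => (t - a 0) * (t - a 1) * (t - a 2) * (t - a 3) * (t - a 4) * (t - a 5))
      ≤ energy (fun t => (t - a 0) * (t - a 1) * (t - a 2) * (t - a 3) * (t - a 4) * (t - a 5)) C

/-- Interpolation nodes for `T = (-1/2, -1/4) ∪ (1/4, 1/2)`. -/
def nodesOuter : Fin 7 → ℝ := ![-1, -1 / 2, -1 / 4, 0, 0, 1 / 4, 1 / 2]

/-- Interpolation nodes for `T = (-1/4, 0) ∪ (1/4, 1/2)`. -/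
def nodesRight : Fin 7 → ℝ := ![-1, -1 / 2, -1 / 2, -1 / 4, 0, 1 / 4, 1 / 2]

/-- Interpolation nodes for `T = (-1/2, -1/4) ∪ (0, 1/4)`. -/
def nodesLeft : Fin 7 → ℝ := ![-1, -1 / 2, -1 / 4, 0, 1 / 4, 1 / 2, 1 / 2]

/-- The vectors `b` are the monomial coefficients of the partial products. The final `linarith` in
each case expresses the nonnegativity of their Gegenbauer coefficients in positive degrees, as a
nonnegative combination of the inequalities of `powerSum_facts`; the same holds for the other two
node sets. -/
theorem hasPositiveNewtonBasis_nodesOuter : HasPositiveNewtonBasis nodesOuter := by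
  intro C hC hN
  obtain ⟨h0, h1, h2, h3, h4, h5, h6⟩ := powerSum_facts hC hN
  refine ⟨?_, ?_, ?_, ?_, ?_, ?_⟩
  · refine barnesWallBound_le_energy_of_coeff hC hN (b := ![1, 1, 0, 0, 0, 0, 0])
      (fun t => ?_) ?_
    · simp only [nodesOuter, Matrix.cons_val]
      ring
    · simp only [Matrix.cons_val]
      linarith
  · refine barnesWallBound_le_energy_of_coeff hC hN (b := ![1 / 2, 3 / 2, 1, 0, 0, 0, 0])
      (fun t => ?_) ?_
    · simp only [nodesOuter, Matrix.cons_val]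
      ring
    · simp only [Matrix.cons_val]
      linarith
  · refine barnesWallBound_le_energy_of_coeff hC hN (b := ![1 / 8, 7 / 8, 7 / 4, 1, 0, 0, 0])
      (fun t => ?_) ?_
    · simp only [nodesOuter, Matrix.cons_val]
      ring
    · simp only [Matrix.cons_val]
      linarith
  · refine barnesWallBound_le_energy_of_coeff hC hN (b := ![0, 1 / 8, 7 / 8, 7 / 4, 1, 0, 0])
      (fun t => ?_) ?_
    · simp only [nodesOuter, Matrix.cons_val]
      ring
    · simp only [Matrix.cons_val]
      linarith
  · refine barnesWallBound_le_energy_of_coeff hC hN (b := ![0, 0, 1 / 8, 7 / 8, 7 / 4, 1, 0])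
      (fun t => ?_) ?_
    · simp only [nodesOuter, Matrix.cons_val]
      ring
    · simp only [Matrix.cons_val]
      linarith
  · refine barnesWallBound_le_energy_of_coeff hC hN (b := ![0, 0, -1 / 32, -3 / 32, 7 / 16, 3 / 2, 1])
      (fun t => ?_) ?_
    · simp only [nodesOuter, Matrix.cons_val]
      ring
    · simp only [Matrix.cons_val]
      linarith

theorem hasPositiveNewtonBasis_nodesRight : HasPositiveNewtonBasis nodesRight := by
  intro C hC hN
  obtain ⟨h0, h1, h2, h3, h4, h5, h6⟩ := powerSum_facts hC hN
  refine ⟨?_, ?_, ?_, ?_, ?_, ?_⟩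
  · refine barnesWallBound_le_energy_of_coeff hC hN (b := ![1, 1, 0, 0, 0, 0, 0])
      (fun t => ?_) ?_
    · simp only [nodesRight, Matrix.cons_val]
      ring
    · simp only [Matrix.cons_val]
      linarith
  · refine barnesWallBound_le_energy_of_coeff hC hN (b := ![1 / 2, 3 / 2, 1, 0, 0, 0, 0])
      (fun t => ?_) ?_
    · simp only [nodesRight, Matrix.cons_val]
      ring
    · simp only [Matrix.cons_val]
      linarith
  · refine barnesWallBound_le_energy_of_coeff hC hN (b := ![1 / 4, 5 / 4, 2, 1, 0, 0, 0])
      (fun t => ?_) ?_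
    · simp only [nodesRight, Matrix.cons_val]
      ring
    · simp only [Matrix.cons_val]
      linarith
  · refine barnesWallBound_le_energy_of_coeff hC hN (b := ![1 / 16, 9 / 16, 7 / 4, 9 / 4, 1, 0, 0])
      (fun t => ?_) ?_
    · simp only [nodesRight, Matrix.cons_val]
      ring
    · simp only [Matrix.cons_val]
      linarith
  · refine barnesWallBound_le_energy_of_coeff hC hN (b := ![0, 1 / 16, 9 / 16, 7 / 4, 9 / 4, 1, 0])
      (fun t => ?_) ?_
    · simp only [nodesRight, Matrix.cons_val]
      ring
    · simp only [Matrix.cons_val]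
      linarith
  · refine barnesWallBound_le_energy_of_coeff hC hN (b := ![0, -1 / 64, -5 / 64, 1 / 8, 19 / 16, 2, 1])
      (fun t => ?_) ?_
    · simp only [nodesRight, Matrix.cons_val]
      ring
    · simp only [Matrix.cons_val]
      linarith

theorem hasPositiveNewtonBasis_nodesLeft : HasPositiveNewtonBasis nodesLeft := by
  intro C hC hN
  obtain ⟨h0, h1, h2, h3, h4, h5, h6⟩ := powerSum_facts hC hN
  refine ⟨?_, ?_, ?_, ?_, ?_, ?_⟩
  · refine barnesWallBound_le_energy_of_coeff hC hN (b := ![1, 1, 0, 0, 0, 0, 0])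
      (fun t => ?_) ?_
    · simp only [nodesLeft, Matrix.cons_val]
      ring
    · simp only [Matrix.cons_val]
      linarith
  · refine barnesWallBound_le_energy_of_coeff hC hN (b := ![1 / 2, 3 / 2, 1, 0, 0, 0, 0])
      (fun t => ?_) ?_
    · simp only [nodesLeft, Matrix.cons_val]
      ring
    · simp only [Matrix.cons_val]
      linarith
  · refine barnesWallBound_le_energy_of_coeff hC hN (b := ![1 / 8, 7 / 8, 7 / 4, 1, 0, 0, 0])
      (fun t => ?_) ?_
    · simp only [nodesLeft, Matrix.cons_val]
      ring
    · simp only [Matrix.cons_val]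
      linarith
  · refine barnesWallBound_le_energy_of_coeff hC hN (b := ![0, 1 / 8, 7 / 8, 7 / 4, 1, 0, 0])
      (fun t => ?_) ?_
    · simp only [nodesLeft, Matrix.cons_val]
      ring
    · simp only [Matrix.cons_val]
      linarith
  · refine barnesWallBound_le_energy_of_coeff hC hN (b := ![0, -1 / 32, -3 / 32, 7 / 16, 3 / 2, 1, 0])
      (fun t => ?_) ?_
    · simp only [nodesLeft, Matrix.cons_val]
      ring
    · simp only [Matrix.cons_val]
      linarith
  · refine barnesWallBound_le_energy_of_coeff hC hN (b := ![0, 1 / 64, 1 / 64, -5 / 16, -5 / 16, 1, 1])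
      (fun t => ?_) ?_
    · simp only [nodesLeft, Matrix.cons_val]
      ring
    · simp only [Matrix.cons_val]
      linarith

/-- The product of all the `t - aᵢ`. -/
def nodePoly (a : Fin 7 → ℝ) (t : ℝ) : ℝ :=
  (t - a 0) * (t - a 1) * (t - a 2) * (t - a 3) * (t - a 4) * (t - a 5) * (t - a 6)

theorem barnesWallBound_le_energy_of_nodes {r : ℝ} (hr : 1 < r) {f : ℕ → ℝ → ℝ}
    (hf : ∀ j, ∀ t ∈ Set.Ioo (-r) r, HasDerivAt (f j) (f (j + 1) t) t)
    (hn : ∀ j, ∀ t ∈ Set.Ioo (-r) r, 0 ≤ f (j + 1) t) {a : Fin 7 → ℝ}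
    (ha : ∀ i, a i ∈ Set.Icc (-1 : ℝ) 1) (hpos : HasPositiveNewtonBasis a)
    (hzero : ∀ t ∈ barnesWallInnerProducts, nodePoly a t = 0) (hC : IsSphericalCode C)
    (hN : C.card = 4320) (hsign : ∀ t ∈ innerProducts C, 0 ≤ nodePoly a t) :
    barnesWallBound (f 0) ≤ energy (f 0) C := by
  have hI : ∀ t ∈ Set.Icc (-1 : ℝ) 1, t ∈ Set.Ioo (-r) r := fun t ht =>
    ⟨by linarith [ht.1], by linarith [ht.2]⟩
  obtain ⟨c, q, hc, hq, e⟩ := exists_newton_interpolation hf hn a fun i => hI _ (ha i)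
  obtain ⟨p1, p2, p3, p4, p5, p6⟩ := hpos C hC hN
  set π1 : ℝ → ℝ := fun t => t - a 0 with hπ1
  set π2 : ℝ → ℝ := fun t => (t - a 0) * (t - a 1) with hπ2
  set π3 : ℝ → ℝ := fun t => (t - a 0) * (t - a 1) * (t - a 2) with hπ3
  set π4 : ℝ → ℝ := fun t => (t - a 0) * (t - a 1) * (t - a 2) * (t - a 3) with hπ4
  set π5 : ℝ → ℝ := fun t => (t - a 0) * (t - a 1) * (t - a 2) * (t - a 3) * (t - a 4) with hπ5
  set π6 : ℝ → ℝ := fun t => (t - a 0) * (t - a 1) * (t - a 2) * (t - a 3) * (t - a 4) * (t - a 5)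
    with hπ6
  set H : ℝ → ℝ := fun t => c 0 * t ^ 0 + c 1 * π1 t + c 2 * π2 t + c 3 * π3 t + c 4 * π4 t
    + c 5 * π5 t + c 6 * π6 t with hH
  have e' : ∀ t ∈ Set.Ioo (-r) r, f 0 t = H t + q t * nodePoly a t := by
    intro t ht
    rw [e t ht]
    simp only [hH, nodePoly, pow_zero, mul_one]
    rfl
  have h1 : energy H C ≤ energy (f 0) C := by
    refine energy_mono fun t ht => ?_
    have h2 := innerProducts_subset_Ico hC ht
    have h3 := hI t ⟨h2.1, h2.2.le⟩
    rw [e' t h3]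
    exact le_add_of_nonneg_right (mul_nonneg (hq t h3) (hsign t ht))
  -- The interpolant agrees with the potential wherever `barnesWallBound` evaluates it, so the bound
  -- may be computed from H.
  have h2 : ∀ t ∈ barnesWallInnerProducts, f 0 t = H t := by
    intro t ht
    rw [e' t, hzero t ht, mul_zero, add_zero]
    apply hI
    rcases ht with rfl | rfl | rfl | rfl | rfl | rfl <;> constructor <;> norm_num
  have h3 : barnesWallBound (f 0) = c 0 * (4320 * 4319) + c 1 * barnesWallBound π1
      + c 2 * barnesWallBound π2 + c 3 * barnesWallBound π3 + c 4 * barnesWallBound π4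
      + c 5 * barnesWallBound π5 + c 6 * barnesWallBound π6 := by
    simp only [barnesWallBound]
    rw [h2 (-1) (by simp [barnesWallInnerProducts]), h2 (-1 / 2) (by simp [barnesWallInnerProducts]),
      h2 (-1 / 4) (by simp [barnesWallInnerProducts]), h2 0 (by simp [barnesWallInnerProducts]),
      h2 (1 / 4) (by simp [barnesWallInnerProducts]), h2 (1 / 2) (by simp [barnesWallInnerProducts])]
    simp only [hH, pow_zero]
    ring
  have h4 : energy H C = c 0 * (4320 * 4319) + c 1 * energy π1 C
      + c 2 * energy π2 C + c 3 * energy π3 C + c 4 * energy π4 C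
      + c 5 * energy π5 C + c 6 * energy π6 C := by
    simp only [hH, energy_add, energy_const_mul, energy_pow hC, (powerSum_facts hC hN).1, hN]
    norm_num
  -- Termwise comparison. The constant term is the same on both sides, 4320 * 4319 ordered pairs, so
  -- no sign is needed for `c 0`.
  refine le_trans ?_ h1
  rw [h3, h4]
  gcongr
  all_goals exact hc _ (by decide)

theorem nodePoly_eq_zero {a : Fin 7 → ℝ} (ha : a ∈ ({nodesOuter, nodesRight, nodesLeft} : Set _))
    {t : ℝ} (ht : t ∈ barnesWallInnerProducts) : nodePoly a t = 0 := by
  rcases ha with rfl | rfl | rfl <;> rcases ht with rfl | rfl | rfl | rfl | rfl | rfl <;>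
    simp only [nodePoly, nodesOuter, nodesRight, nodesLeft, Matrix.cons_val] <;> norm_num

/-- The bound for potentials that are smooth on a neighbourhood of `[-1, 1]`. -/
theorem barnesWallBound_le_energy_of_tower {T : Set ℝ} (hT : T ∈ avoidedSets) {r : ℝ} (hr : 1 < r)
    {f : ℕ → ℝ → ℝ} (hf : ∀ j, ∀ t ∈ Set.Ioo (-r) r, HasDerivAt (f j) (f (j + 1) t) t)
    (hn : ∀ j, ∀ t ∈ Set.Ioo (-r) r, 0 ≤ f (j + 1) t) (hC : IsSphericalCode C)
    (hav : IsAvoiding T C) (hN : C.card = 4320) : barnesWallBound (f 0) ≤ energy (f 0) C := by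
  have hav' : ∀ t ∈ innerProducts C, t ∉ T := fun t ht h =>
    Set.notMem_empty t (hav ▸ ⟨ht, h⟩)
  -- A quadratic with roots at the two ends of a gap is nonnegative outside the gap.
  have hsgn : ∀ x y s : ℝ, x ≤ y → ¬ (x < s ∧ s < y) → 0 ≤ (s - x) * (s - y) := by
    intro x y s hxy h
    by_cases h1 : x < s
    · have : y ≤ s := not_lt.1 fun h2 => h ⟨h1, h2⟩
      exact mul_nonneg (by linarith) (by linarith)
    · exact mul_nonneg_of_nonpos_of_nonpos (by linarith) (by linarith)
  have h1 : ∀ t ∈ innerProducts C, 0 ≤ t + 1 := fun t ht => by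
    linarith [(innerProducts_subset_Ico hC ht).1]
  rcases hT with rfl | rfl | rfl
  · refine barnesWallBound_le_energy_of_nodes hr hf hn (a := nodesOuter) ?_
      hasPositiveNewtonBasis_nodesOuter (fun t => nodePoly_eq_zero (by simp)) hC hN ?_
    · intro i
      fin_cases i <;> constructor <;> norm_num [nodesOuter]
    · intro t ht
      have h2 := hsgn (-1 / 2) (-1 / 4) t (by norm_num) fun h => hav' t ht (Or.inl h)
      have h3 := hsgn (1 / 4) (1 / 2) t (by norm_num) fun h => hav' t ht (Or.inr h)
      -- The node polynomial is grouped as t + 1, the square of the doubled node factor, and one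
      -- quadratic for each gap.
      have := mul_nonneg (mul_nonneg (h1 t ht) (sq_nonneg t)) (mul_nonneg h2 h3)
      refine this.trans_eq ?_
      simp only [nodePoly, nodesOuter, Matrix.cons_val]
      ring
  · refine barnesWallBound_le_energy_of_nodes hr hf hn (a := nodesRight) ?_
      hasPositiveNewtonBasis_nodesRight (fun t => nodePoly_eq_zero (by simp)) hC hN ?_
    · intro i
      fin_cases i <;> constructor <;> norm_num [nodesRight]
    · intro t ht
      have h2 := hsgn (-1 / 4) 0 t (by norm_num) fun h => hav' t ht (Or.inl h)
      have h3 := hsgn (1 / 4) (1 / 2) t (by norm_num) fun h => hav' t ht (Or.inr h)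
      have := mul_nonneg (mul_nonneg (h1 t ht) (sq_nonneg (t + 1 / 2))) (mul_nonneg h2 h3)
      refine this.trans_eq ?_
      simp only [nodePoly, nodesRight, Matrix.cons_val]
      ring
  · refine barnesWallBound_le_energy_of_nodes hr hf hn (a := nodesLeft) ?_
      hasPositiveNewtonBasis_nodesLeft (fun t => nodePoly_eq_zero (by simp)) hC hN ?_
    · intro i
      fin_cases i <;> constructor <;> norm_num [nodesLeft]
    · intro t ht
      have h2 := hsgn (-1 / 2) (-1 / 4) t (by norm_num) fun h => hav' t ht (Or.inl h)
      have h3 := hsgn 0 (1 / 4) t (by norm_num) fun h => hav' t ht (Or.inr h)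
      have := mul_nonneg (mul_nonneg (h1 t ht) (sq_nonneg (t - 1 / 2))) (mul_nonneg h2 h3)
      refine this.trans_eq ?_
      simp only [nodePoly, nodesLeft, Matrix.cons_val]
      ring

/-! ### Passage to potentials that are only continuous at -1 -/

theorem IsAbsolutelyMonotone.tendsto_comp_mul {h : ℝ → ℝ} (hh : IsAbsolutelyMonotone h) {t : ℝ}
    (ht : t ∈ Set.Ico (-1 : ℝ) 1) :
    Filter.Tendsto (fun c => h (c * t)) (nhdsWithin 1 (Set.Ioo 0 1)) (nhds (h t)) := by
  have h1 := hh.1 t ht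
  refine Filter.Tendsto.comp h1 (tendsto_nhdsWithin_iff.2 ⟨?_, ?_⟩)
  · have : Filter.Tendsto (fun c : ℝ => c * t) (nhds 1) (nhds (1 * t)) :=
      (continuous_id.mul continuous_const).tendsto 1
    rw [one_mul] at this
    exact this.mono_left nhdsWithin_le_nhds
  · filter_upwards [self_mem_nhdsWithin] with c hc
    constructor
    · nlinarith [hc.1, hc.2, ht.1]
    · nlinarith [hc.1, hc.2, ht.2]

/-- The energy bound for all absolutely monotone potentials. -/
theorem barnesWallBound_le_energy {T : Set ℝ} (hT : T ∈ avoidedSets) {h : ℝ → ℝ}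
    (hh : IsAbsolutelyMonotone h) (hC : IsSphericalCode C)
    (hav : IsAvoiding T C) (hN : C.card = 4320) : barnesWallBound h ≤ energy h C := by
  have hne : (nhdsWithin (1 : ℝ) (Set.Ioo 0 1)).NeBot := by
    rw [← mem_closure_iff_nhdsWithin_neBot, closure_Ioo zero_ne_one]
    exact ⟨zero_le_one, le_rfl⟩
  refine le_of_tendsto_of_tendsto (b := nhdsWithin (1 : ℝ) (Set.Ioo 0 1))
    (f := fun c => barnesWallBound fun t => h (c * t)) (g := fun c => energy (fun t => h (c * t)) C)
    ?_ ?_ ?_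
  · have := fun t ht => hh.tendsto_comp_mul (t := t) ht
    have e1 := this (-1) (by constructor <;> norm_num)
    have e2 := this (-1 / 2) (by constructor <;> norm_num)
    have e3 := this (-1 / 4) (by constructor <;> norm_num)
    have e4 := this 0 (by constructor <;> norm_num)
    have e5 := this (1 / 4) (by constructor <;> norm_num)
    have e6 := this (1 / 2) (by constructor <;> norm_num)
    exact (((((e2.add e6).const_mul 280).add ((e3.add e5).const_mul 1024)).add
      (e4.const_mul 1710)).add e1).const_mul 4320
  · refine tendsto_finsetSum _ fun p hp => hh.tendsto_comp_mul (innerProducts_subset_Ico hC ?_)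
    rw [Finset.mem_offDiag] at hp
    exact ⟨p.1, hp.1, p.2, hp.2.1, hp.2.2, rfl⟩
  -- For c < 1 the function h(ct) is smooth on (-1/c, 1/c), an open interval containing [-1, 1],
  -- with derivatives cʲ h⁽ʲ⁾(ct).
  · filter_upwards [self_mem_nhdsWithin] with c hc
    have hmem : ∀ t ∈ Set.Ioo (-c⁻¹) c⁻¹, c * t ∈ Set.Ioo (-1 : ℝ) 1 := by
      intro t ht
      have := mul_inv_cancel₀ hc.1.ne'
      constructor <;> nlinarith [mul_lt_mul_of_pos_left ht.1 hc.1, mul_lt_mul_of_pos_left ht.2 hc.1]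
    have := barnesWallBound_le_energy_of_tower hT (r := c⁻¹) ((one_lt_inv₀ hc.1).2 hc.2)
      (f := fun j t => c ^ j * iteratedDeriv j h (c * t)) ?_ ?_ hC hav hN
    · simpa using this
    · intro j t ht
      have h1 := (hh.hasDerivAt j (hmem t ht)).comp t ((hasDerivAt_id t).const_mul c)
      have h2 := h1.const_mul (c ^ j)
      rw [show c ^ (j + 1) * iteratedDeriv (j + 1) h (c * t)
        = c ^ j * (iteratedDeriv (j + 1) h (c * t) * (c * 1)) by ring]
      exact h2
    · intro j t ht
      exact mul_nonneg (pow_nonneg hc.1.le _) (hh.2.2 (j + 1) (by omega) _ (hmem t ht))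

/-! ### Distance distribution from moments -/

/-- The points y are grouped by their inner product with x. The value 1 is attained only at y = x,
which accounts for the isolated term `φ 1`. -/
theorem sum_inner_eq (hC : IsSphericalCode C) (hI : innerProducts C ⊆ barnesWallInnerProducts)
    (φ : ℝ → ℝ) {x : EuclideanSpace ℝ (Fin 16)} (hx : x ∈ C) :
    ∑ y ∈ C, φ (inner ℝ x y) = φ 1 + distanceCount C x (-1) * φ (-1)
      + distanceCount C x (-1 / 2) * φ (-1 / 2) + distanceCount C x (-1 / 4) * φ (-1 / 4)
      + distanceCount C x 0 * φ 0 + distanceCount C x (1 / 4) * φ (1 / 4)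
      + distanceCount C x (1 / 2) * φ (1 / 2) := by
  classical
  have hself : (inner ℝ x x : ℝ) = 1 := by rw [real_inner_self_eq_norm_sq, hC x hx, one_pow]
  have hmaps : ∀ y ∈ C, (inner ℝ x y : ℝ) ∈ ({1, -1, -1 / 2, -1 / 4, 0, 1 / 4, 1 / 2} : Finset ℝ) := by
    intro y hy
    by_cases hxy : x = y
    · rw [← hxy, hself]
      simp
    · have := hI ⟨x, hx, y, hy, hxy, rfl⟩
      simp only [barnesWallInnerProducts, Set.mem_insert_iff, Set.mem_singleton_iff] at this
      simp only [Finset.mem_insert, Finset.mem_singleton]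
      exact Or.inr this
  have hone : (C.filter fun y => (inner ℝ x y : ℝ) = 1) = {x} := by
    ext y
    simp only [Finset.mem_filter, Finset.mem_singleton]
    constructor
    · rintro ⟨hy, h⟩
      exact ((inner_eq_one_iff_of_norm_eq_one (hC x hx) (hC y hy)).1 h).symm
    · rintro rfl
      exact ⟨hx, hself⟩
  rw [← Finset.sum_fiberwise_of_maps_to hmaps]
  have hfib : ∀ t : ℝ, (∑ y ∈ C with (inner ℝ x y : ℝ) = t, φ (inner ℝ x y))
      = ((C.filter fun y => (inner ℝ x y : ℝ) = t).card : ℝ) * φ t := by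
    intro t
    rw [Finset.sum_congr rfl (g := fun _ => φ t) fun y hy => by rw [(Finset.mem_filter.1 hy).2]]
    simp
  have hd : ∀ t : ℝ, distanceCount C x t = (C.filter fun y => (inner ℝ x y : ℝ) = t).card := by
    intro t
    unfold distanceCount
    congr!
  simp only [hfib, hd]
  repeat rw [Finset.sum_insert (by norm_num)]
  rw [Finset.sum_singleton, hone]
  simp only [Finset.card_singleton, Nat.cast_one]
  ring

/-- The distance distribution is determined by the first five moments. -/
theorem hasBarnesWallDistribution_of_moments (hC : IsSphericalCode C) (hN : C.card = 4320)
    (hI : innerProducts C ⊆ barnesWallInnerProducts)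
    (h1 : ∀ x ∈ C, ∑ y ∈ C, (inner ℝ x y : ℝ) = 0)
    (h2 : ∀ x ∈ C, ∑ y ∈ C, (inner ℝ x y : ℝ) ^ 2 = 270)
    (h3 : ∀ x ∈ C, ∑ y ∈ C, (inner ℝ x y : ℝ) ^ 3 = 0)
    (h4 : ∀ x ∈ C, ∑ y ∈ C, (inner ℝ x y : ℝ) ^ 4 = 45)
    (h5 : ∀ x ∈ C, ∑ y ∈ C, (inner ℝ x y : ℝ) ^ 5 = 0) : HasBarnesWallDistribution C := by
  intro x hx
  have e0 := sum_inner_eq hC hI (fun _ => 1) hx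
  have e1 := sum_inner_eq hC hI (fun t => t) hx
  have e2 := sum_inner_eq hC hI (fun t => t ^ 2) hx
  have e3 := sum_inner_eq hC hI (fun t => t ^ 3) hx
  have e4 := sum_inner_eq hC hI (fun t => t ^ 4) hx
  have e5 := sum_inner_eq hC hI (fun t => t ^ 5) hx
  simp only [h1 x hx, h2 x hx, h3 x hx, h4 x hx, h5 x hx, Finset.sum_const, hN, nsmul_eq_mul]
    at e0 e1 e2 e3 e4 e5
  push_cast at e0
  -- Six unknown counts satisfy six linear equations whose matrix is the Vandermonde matrix of the
  -- six distinct inner products, so each count is a linear combination of the moments.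
  refine ⟨?_, ?_, ?_, ?_, ?_, ?_⟩ <;> rw [← Nat.cast_inj (R := ℝ)] <;> push_cast <;> linarith

theorem energy_eq_barnesWallBound (hC : IsSphericalCode C) (hN : C.card = 4320)
    (hI : innerProducts C ⊆ barnesWallInnerProducts) (hD : HasBarnesWallDistribution C)
    (h : ℝ → ℝ) : energy h C = barnesWallBound h := by
  rw [energy_eq_sum_sub hC, Finset.sum_congr rfl fun x hx => sum_inner_eq hC hI h hx]
  have : ∀ x ∈ C, h 1 + distanceCount C x (-1) * h (-1)
      + distanceCount C x (-1 / 2) * h (-1 / 2) + distanceCount C x (-1 / 4) * h (-1 / 4)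
      + distanceCount C x 0 * h 0 + distanceCount C x (1 / 4) * h (1 / 4)
      + distanceCount C x (1 / 2) * h (1 / 2)
      = h 1 + 1 * h (-1) + 280 * h (-1 / 2) + 1024 * h (-1 / 4) + 1710 * h 0 + 1024 * h (1 / 4)
      + 280 * h (1 / 2) := by
    intro x hx
    obtain ⟨d1, d2, d3, d4, d5, d6⟩ := hD x hx
    rw [d1, d2, d3, d4, d5, d6]
    norm_num
  rw [Finset.sum_congr rfl this, Finset.sum_const, hN, nsmul_eq_mul, barnesWallBound]
  push_cast
  ring

theorem isDistanceInvariant_of_distribution (hI : innerProducts C ⊆ barnesWallInnerProducts)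
    (hD : HasBarnesWallDistribution C) : IsDistanceInvariant C := by
  intro t ht x hx y hy
  obtain ⟨a1, a2, a3, a4, a5, a6⟩ := hD x hx
  obtain ⟨b1, b2, b3, b4, b5, b6⟩ := hD y hy
  rcases hI ht with rfl | rfl | rfl | rfl | rfl | rfl
  · rw [a1, b1]
  · rw [a2, b2]
  · rw [a3, b3]
  · rw [a4, b4]
  · rw [a5, b5]
  · rw [a6, b6]

theorem innerProducts_eq_of_distribution (hC : IsSphericalCode C) (hN : C.card = 4320)
    (hI : innerProducts C ⊆ barnesWallInnerProducts) (hD : HasBarnesWallDistribution C) :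
    innerProducts C = barnesWallInnerProducts := by
  refine hI.antisymm fun t ht => ?_
  obtain ⟨x, hx⟩ : C.Nonempty := Finset.card_pos.1 (by omega)
  obtain ⟨a1, a2, a3, a4, a5, a6⟩ := hD x hx
  have hpos : 0 < distanceCount C x t := by
    rcases ht with rfl | rfl | rfl | rfl | rfl | rfl <;> omega
  obtain ⟨y, hy⟩ := Finset.card_pos.1 hpos
  rw [Finset.mem_filter] at hy
  refine ⟨x, hx, y, hy.1, ?_, hy.2⟩
  rintro rfl
  have h1 := hy.2
  rw [real_inner_self_eq_norm_sq, hC x hx, one_pow] at h1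
  subst h1
  norm_num [barnesWallInnerProducts] at ht

/-! ### Moments of the sphere -/

open MeasureTheory Metric

section Sphere

variable {n : ℕ}

local notation "E" => EuclideanSpace ℝ (Fin n)

/-- The action of a linear isometry on the unit sphere. -/
def sphereHomeomorph (g : E ≃ₗᵢ[ℝ] E) : sphere (0 : E) 1 ≃ₜ sphere (0 : E) 1 :=
  g.toHomeomorph.subtype fun x => by simp

open scoped Pointwise in
-- The surface measure of s is the dimension times the volume of the cone (0,1)·s. A linear isometry
-- commutes with forming the cone and preserves volume.
theorem measurePreserving_sphereHomeomorph (g : E ≃ₗᵢ[ℝ] E) :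
    MeasurePreserving (sphereHomeomorph g) (volume : Measure E).toSphere
      (volume : Measure E).toSphere := by
  refine ⟨(sphereHomeomorph g).continuous.measurable, ?_⟩
  ext s hs
  have hm := (sphereHomeomorph g).continuous.measurable hs
  rw [Measure.map_apply (sphereHomeomorph g).continuous.measurable hs,
    Measure.toSphere_apply' _ hs, Measure.toSphere_apply' _ hm]
  congr 1
  rw [← g.measurePreserving.measure_preimage_emb g.toHomeomorph.measurableEmbedding
    (Set.Ioo (0 : ℝ) 1 • (Subtype.val '' s))]
  congr 1
  ext v
  simp only [Set.mem_smul, Set.mem_image, Set.mem_preimage]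
  constructor
  · rintro ⟨r, hr, _, ⟨u, hu, rfl⟩, rfl⟩
    exact ⟨r, hr, _, ⟨_, hu, rfl⟩, by rw [map_smul]; rfl⟩
  · rintro ⟨r, hr, _, ⟨u, hu, rfl⟩, h⟩
    refine ⟨r, hr, _, ⟨(sphereHomeomorph g).symm u, ?_, rfl⟩, ?_⟩
    · simpa using hu
    · apply g.injective
      rw [← h, map_smul]
      have : g ((sphereHomeomorph g).symm u : E) = sphereHomeomorph g ((sphereHomeomorph g).symm u) :=
        rfl
      rw [this, Homeomorph.apply_symm_apply]

theorem integral_sphere_comp_isometry (g : E ≃ₗᵢ[ℝ] E) (f : E → ℝ) :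
    ∫ u : sphere (0 : E) 1, f (g u) ∂(volume : Measure E).toSphere
      = ∫ u : sphere (0 : E) 1, f u ∂(volume : Measure E).toSphere :=
  (measurePreserving_sphereHomeomorph g).integral_comp
    (sphereHomeomorph g).measurableEmbedding fun u => f u

theorem integrable_sphere {f : E → ℝ} (hf : Continuous f) :
    Integrable (fun u : sphere (0 : E) 1 => f u) (volume : Measure E).toSphere :=
  (hf.comp continuous_subtype_val).integrable_of_hasCompactSupport
    (HasCompactSupport.of_compactSpace _)

theorem integral_sphere_add {f g : E → ℝ} (hf : Continuous f) (hg : Continuous g) :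
    ∫ u : sphere (0 : E) 1, (f u + g u) ∂(volume : Measure E).toSphere
      = ∫ u : sphere (0 : E) 1, f u ∂(volume : Measure E).toSphere
        + ∫ u : sphere (0 : E) 1, g u ∂(volume : Measure E).toSphere :=
  integral_add (integrable_sphere hf) (integrable_sphere hg)

theorem integral_sphere_sum {ι : Type*} (s : Finset ι) {f : ι → E → ℝ}
    (hf : ∀ i ∈ s, Continuous (f i)) :
    ∫ u : sphere (0 : E) 1, ∑ i ∈ s, f i u ∂(volume : Measure E).toSphere
      = ∑ i ∈ s, ∫ u : sphere (0 : E) 1, f i u ∂(volume : Measure E).toSphere :=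
  integral_finsetSum s fun i hi => integrable_sphere (hf i hi)

theorem integral_sphere_inner_pow_odd (v : E) {k : ℕ} (hk : Odd k) :
    ∫ u : sphere (0 : E) 1, (inner ℝ v u : ℝ) ^ k ∂(volume : Measure E).toSphere = 0 := by
  have h := integral_sphere_comp_isometry (LinearIsometryEquiv.neg ℝ) fun u : E =>
    (inner ℝ v u : ℝ) ^ k
  simp only [LinearIsometryEquiv.coe_neg, inner_neg_right, hk.neg_pow, integral_neg] at h
  linarith

theorem integral_sphere_inner_pow_eq {v w : E} (hv : ‖v‖ = 1) (hw : ‖w‖ = 1) (k : ℕ) :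
    ∫ u : sphere (0 : E) 1, (inner ℝ v u : ℝ) ^ k ∂(volume : Measure E).toSphere
      = ∫ u : sphere (0 : E) 1, (inner ℝ w u : ℝ) ^ k ∂(volume : Measure E).toSphere := by
  -- The reflection in the hyperplane orthogonal to v - w carries v to w, because the two have equal
  -- norm.
  have hg := Submodule.reflection_sub (hv.trans hw.symm)
  set g := (ℝ ∙ (v - w))ᗮ.reflection
  rw [← integral_sphere_comp_isometry g fun u : E => (inner ℝ w u : ℝ) ^ k]
  congr 1
  ext u
  rw [← hg, g.inner_map_map]

end Sphere

local notation "E" => EuclideanSpace ℝ (Fin 16)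

/-- All sixteen coordinates have the same second moment, and their squares sum to 1. -/
theorem integral_sphere_inner_sq {v : E} (hv : ‖v‖ = 1) :
    16 * ∫ u : sphere (0 : E) 1, (inner ℝ v u : ℝ) ^ 2 ∂(volume : Measure E).toSphere
      = (volume : Measure E).toSphere.real Set.univ := by
  have h1 : ∀ i : Fin 16, ∫ u : sphere (0 : E) 1, (u : E) i ^ 2 ∂(volume : Measure E).toSphere
      = ∫ u : sphere (0 : E) 1, (inner ℝ v u : ℝ) ^ 2 ∂(volume : Measure E).toSphere := by
    intro i
    rw [integral_sphere_inner_pow_eq hv (w := EuclideanSpace.single i 1) (by simp)]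
    simp [EuclideanSpace.inner_single_left]
  have h2 : ∫ u : sphere (0 : E) 1, ∑ i, (u : E) i ^ 2 ∂(volume : Measure E).toSphere
      = (volume : Measure E).toSphere.real Set.univ := by
    rw [integral_congr_ae (g := fun _ => (1 : ℝ))]
    · simp
    · exact Filter.Eventually.of_forall fun u =>
        EuclideanSpace.sum_sq_eq_one (by simp)
  rw [integral_finsetSum _ fun i _ => integrable_sphere (f := fun u => u i ^ 2) (by fun_prop),
    Finset.sum_congr rfl fun i _ => h1 i] at h2
  simpa using h2

/-- Invariance applied to the unit vectors (eᵢ ± eⱼ)/√2 determines the mixed moments of uᵢ²uⱼ² from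
the pure one. Integrating (∑ uᵢ²)² = 1 then gives 16(m + 15·m/3) = 96m for the total mass. -/
theorem integral_sphere_inner_pow_four {v : E} (hv : ‖v‖ = 1) :
    96 * ∫ u : sphere (0 : E) 1, (inner ℝ v u : ℝ) ^ 4 ∂(volume : Measure E).toSphere
      = (volume : Measure E).toSphere.real Set.univ := by
  set σ := (volume : Measure E).toSphere with hσ
  set m := ∫ u : sphere (0 : E) 1, (inner ℝ v u : ℝ) ^ 4 ∂σ with hm
  have h1 : ∀ i : Fin 16, ∫ u : sphere (0 : E) 1, (u : E) i ^ 4 ∂σ = m := by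
    intro i
    rw [hm, hσ, integral_sphere_inner_pow_eq hv (w := EuclideanSpace.single i 1) (by simp)]
    simp [EuclideanSpace.inner_single_left]
  have h2 : ∀ i j : Fin 16, i ≠ j → ∀ s : ℝ, s ^ 2 = 1 →
      ∫ u : sphere (0 : E) 1, ((u : E) i + s * (u : E) j) ^ 4 ∂σ = 4 * m := by
    intro i j hij s hs
    have hw : ‖(1 / √2) • (EuclideanSpace.single i 1 + s • EuclideanSpace.single j 1 : E)‖ = 1 := by
      have h3 : ‖(EuclideanSpace.single i 1 + s • EuclideanSpace.single j 1 : E)‖ ^ 2 = 2 := by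
        rw [@norm_add_sq_real, norm_smul, inner_smul_right]
        simp [EuclideanSpace.inner_single_left, hij, hs]
        norm_num
      rw [norm_smul, ← Real.sqrt_sq (norm_nonneg (_ + _)), h3, Real.norm_of_nonneg (by positivity)]
      exact div_mul_cancel₀ _ (by positivity)
    rw [hm, hσ, integral_sphere_inner_pow_eq hv hw, ← integral_const_mul]
    congr 1
    ext u
    rw [inner_smul_left, inner_add_left, inner_smul_left, mul_pow]
    simp only [EuclideanSpace.inner_single_left, map_one, one_mul, conj_trivial, div_pow, one_pow]
    rw [show √2 ^ 4 = (√2 ^ 2) ^ 2 by ring, Real.sq_sqrt (by norm_num)]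
    ring
  have h3 : ∀ i j : Fin 16, i ≠ j → ∫ u : sphere (0 : E) 1, (u : E) i ^ 2 * (u : E) j ^ 2 ∂σ
      = m / 3 := by
    intro i j hij
    have e1 := h2 i j hij 1 (by norm_num)
    have e2 := h2 i j hij (-1) (by norm_num)
    have e3 := integral_sphere_add (f := fun u : E => (u i + 1 * u j) ^ 4)
      (g := fun u : E => (u i + -1 * u j) ^ 4) (by fun_prop) (by fun_prop)
    have e4 := integral_sphere_add (f := fun u : E => 12 * (u i ^ 2 * u j ^ 2))
      (g := fun u : E => 2 * u i ^ 4 + 2 * u j ^ 4) (by fun_prop) (by fun_prop)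
    have e5 := integral_sphere_add (f := fun u : E => 2 * u i ^ 4)
      (g := fun u : E => 2 * u j ^ 4) (by fun_prop) (by fun_prop)
    rw [integral_const_mul, integral_const_mul, h1, h1] at e5
    rw [e5, integral_const_mul] at e4
    rw [e1, e2] at e3
    -- Adding the two signs removes the odd mixed terms, leaving 8m = 12 ∫uᵢ²uⱼ² + 4m.
    have e6 : ∀ u : E, (u i + 1 * u j) ^ 4 + (u i + -1 * u j) ^ 4
        = 12 * (u i ^ 2 * u j ^ 2) + (2 * u i ^ 4 + 2 * u j ^ 4) := fun u => by ring
    simp only [e6] at e3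
    rw [e4] at e3
    linarith
  have h4 : ∫ u : sphere (0 : E) 1, ∑ i, ∑ j, (u : E) i ^ 2 * (u : E) j ^ 2 ∂σ
      = σ.real Set.univ := by
    rw [integral_congr_ae (g := fun _ => (1 : ℝ))]
    · simp
    · refine Filter.Eventually.of_forall fun u => ?_
      have := EuclideanSpace.sum_sq_eq_one (x := (u : E)) (by simp)
      simp only [← Finset.mul_sum, ← Finset.sum_mul, this, one_mul]
  have h5 : ∀ i, ∑ j, ∫ u : sphere (0 : E) 1, (u : E) i ^ 2 * (u : E) j ^ 2 ∂σ = 6 * m := by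
    intro i
    rw [← Finset.add_sum_erase _ _ (Finset.mem_univ i),
      Finset.sum_congr rfl fun j hj => h3 i j (Finset.ne_of_mem_erase hj).symm]
    have : ∫ u : sphere (0 : E) 1, (u : E) i ^ 2 * (u : E) i ^ 2 ∂σ = m := by
      rw [← h1 i]
      congr 1
      ext u
      ring
    rw [this]
    simp
    ring
  rw [integral_sphere_sum Finset.univ (f := fun i u => ∑ j, u i ^ 2 * u j ^ 2)
    fun i _ => by fun_prop] at h4
  have h6 : ∀ i, ∫ u : sphere (0 : E) 1, ∑ j, (u : E) i ^ 2 * (u : E) j ^ 2 ∂σ = 6 * m := fun i =>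
    (integral_sphere_sum Finset.univ (f := fun j u => u i ^ 2 * u j ^ 2)
      fun j _ => by fun_prop).trans (h5 i)
  rw [Finset.sum_congr rfl fun i _ => h6 i] at h4
  rw [← h4, Finset.sum_const, Finset.card_univ, Fintype.card_fin, nsmul_eq_mul]
  push_cast
  ring

theorem toSphere_real_univ_ne_zero : (volume : Measure E).toSphere.real Set.univ ≠ 0 := by
  rw [Measure.real, ENNReal.toReal_ne_zero]
  exact ⟨Measure.measure_univ_ne_zero.2 (Measure.toSphere_ne_zero _), measure_ne_top _ _⟩

/-- Averages of powers of linear forms over a spherical design. -/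
theorem IsSphericalDesign.sum_inner_pow {τ : ℕ} (hD : IsSphericalDesign τ C) {k : ℕ} (hk : k ≤ τ)
    (x : E) : (C.card : ℝ) *
      ∫ u : sphere (0 : E) 1, (inner ℝ x u : ℝ) ^ k ∂(volume : Measure E).toSphere
      = (volume : Measure E).toSphere.real Set.univ * ∑ y ∈ C, (inner ℝ x y : ℝ) ^ k := by
  have heval : ∀ u : E, eval (fun i => u i) (pointForm x ^ k) = (inner ℝ x u : ℝ) ^ k := by
    intro u
    simp [pointForm, linForm, EuclideanSpace.inner_eq_sum_mul]
  have hdeg : (pointForm x ^ k).totalDegree ≤ τ := by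
    refine (totalDegree_pow _ _).trans ?_
    have : (pointForm x).totalDegree ≤ 1 := by
      refine totalDegree_finsetSum_le fun i _ => (totalDegree_mul _ _).trans ?_
      simp
    nlinarith
  have h := hD.2.2 _ hdeg
  simp only [heval] at h
  rw [average_eq, smul_eq_mul] at h
  have h1 : (C.card : ℝ) ≠ 0 := by exact_mod_cast hD.2.1.card_pos.ne'
  have h2 := toSphere_real_univ_ne_zero
  field_simp at h
  linarith

theorem IsSphericalDesign.hasBarnesWallDistribution (hD : IsSphericalDesign 7 C)
    (hN : C.card = 4320) (hI : innerProducts C ⊆ barnesWallInnerProducts) :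
    HasBarnesWallDistribution C := by
  have hV := toSphere_real_univ_ne_zero
  have hodd : ∀ k : ℕ, k ≤ 7 → Odd k → ∀ x ∈ C, ∑ y ∈ C, (inner ℝ x y : ℝ) ^ k = 0 := by
    intro k hk ho x _
    have := hD.sum_inner_pow hk x
    rw [integral_sphere_inner_pow_odd _ ho, mul_zero] at this
    exact (mul_eq_zero.1 this.symm).resolve_left hV
  refine hasBarnesWallDistribution_of_moments hD.1 hN hI ?_ ?_ (hodd 3 (by norm_num) (by decide)) ?_
    (hodd 5 (by norm_num) (by decide))
  · intro x hx
    simpa using hodd 1 (by norm_num) (by decide) x hx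
  · intro x hx
    have h1 := hD.sum_inner_pow (k := 2) (by norm_num) x
    have h2 := integral_sphere_inner_sq (hD.1 x hx)
    rw [hN] at h1
    refine mul_left_cancel₀ hV ?_
    rw [← h1]
    push_cast
    linarith
  · intro x hx
    have h1 := hD.sum_inner_pow (k := 4) (by norm_num) x
    have h2 := integral_sphere_inner_pow_four (hD.1 x hx)
    rw [hN] at h1
    refine mul_left_cancel₀ hV ?_
    rw [← h1]
    push_cast
    linarith

/-! ### Sums over sign patterns -/

section SignSums

variable {ι : Type*} [DecidableEq ι]

/-- The value of the linear form `x` on the sign vector supported on `W` and negative on `M`. -/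
def signSum (x : ι → ℝ) (W M : Finset ι) : ℝ := ∑ i ∈ W, x i - 2 * ∑ i ∈ M, x i

theorem sum_powerset_insert_signSum (x : ι → ℝ) {W : Finset ι} {i : ι} (hi : i ∉ W)
    (φ : ℕ → ℝ → ℝ) :
    ∑ M ∈ (insert i W).powerset, φ M.card (signSum x (insert i W) M)
      = ∑ M ∈ W.powerset, φ M.card (x i + signSum x W M)
        + ∑ M ∈ W.powerset, φ (M.card + 1) (-x i + signSum x W M) := by
  rw [Finset.sum_powerset_insert hi]
  congr 1
  · refine Finset.sum_congr rfl fun M hM => ?_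
    rw [signSum, signSum, Finset.sum_insert hi]
    ring_nf
  · refine Finset.sum_congr rfl fun M hM => ?_
    have hiM : i ∉ M := fun h => hi (Finset.mem_powerset.1 hM h)
    rw [signSum, signSum, Finset.sum_insert hi, Finset.sum_insert hiM, Finset.card_insert_of_notMem hiM]
    ring_nf

/-- The free shift `a` carries the induction: adding a point i to W replaces a by a + xᵢ and a - xᵢ.
-/
theorem sum_signSum_pow_two (x : ι → ℝ) (W : Finset ι) (a : ℝ) :
    ∑ M ∈ W.powerset, (a + signSum x W M) ^ 2 = 2 ^ W.card * (a ^ 2 + ∑ i ∈ W, x i ^ 2) := by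
  induction W using Finset.induction_on generalizing a with
  | empty => simp [signSum]
  | insert i W hi ih =>
    rw [sum_powerset_insert_signSum x hi fun _ t => (a + t) ^ 2]
    simp only [← add_assoc]
    rw [ih, ih, Finset.card_insert_of_notMem hi, Finset.sum_insert hi]
    ring

theorem sum_signSum_pow_four (x : ι → ℝ) (W : Finset ι) (a : ℝ) :
    ∑ M ∈ W.powerset, (a + signSum x W M) ^ 4 = 2 ^ W.card * (a ^ 4 + 6 * a ^ 2 * ∑ i ∈ W, x i ^ 2
      + 3 * (∑ i ∈ W, x i ^ 2) ^ 2 - 2 * ∑ i ∈ W, x i ^ 4) := by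
  induction W using Finset.induction_on generalizing a with
  | empty => simp [signSum]
  | insert i W hi ih =>
    rw [sum_powerset_insert_signSum x hi fun _ t => (a + t) ^ 4]
    simp only [← add_assoc]
    rw [ih, ih, Finset.card_insert_of_notMem hi, Finset.sum_insert hi, Finset.sum_insert hi]
    ring

/-- The alternating sum is an iterated finite difference of order |W|, which annihilates polynomials
of degree k < |W|. -/
theorem sum_neg_one_pow_card_mul_signSum_pow (x : ι → ℝ) (W : Finset ι) (a : ℝ) {k : ℕ}
    (hk : k < W.card) :
    ∑ M ∈ W.powerset, (-1 : ℝ) ^ M.card * (a + signSum x W M) ^ k = 0 := by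
  induction W using Finset.induction_on generalizing a k with
  | empty => simp at hk
  | insert i W hi ih =>
    rw [sum_powerset_insert_signSum x hi fun m t => (-1 : ℝ) ^ m * (a + t) ^ k]
    rw [Finset.card_insert_of_notMem hi] at hk
    -- Expanding in powers of c, the terms with j < k vanish by induction, since then j < |W|. The
    -- sum is thus independent of c, and the contributions of c = xᵢ and c = -xᵢ cancel.
    have key : ∀ c : ℝ, ∑ M ∈ W.powerset, (-1 : ℝ) ^ M.card * (a + (c + signSum x W M)) ^ k
        = ∑ M ∈ W.powerset, (-1 : ℝ) ^ M.card * (a + signSum x W M) ^ k := by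
      intro c
      have h1 : ∀ M, (-1 : ℝ) ^ M.card * (a + (c + signSum x W M)) ^ k
          = ∑ j ∈ Finset.range (k + 1), (c ^ (k - j) * k.choose j)
            * ((-1 : ℝ) ^ M.card * (a + signSum x W M) ^ j) := by
        intro M
        rw [show a + (c + signSum x W M) = (a + signSum x W M) + c by ring, add_pow,
          Finset.mul_sum]
        exact Finset.sum_congr rfl fun j _ => by ring
      rw [Finset.sum_congr rfl fun M _ => h1 M, Finset.sum_comm, Finset.sum_range_succ,
        Finset.sum_eq_zero fun j hj => ?_]
      · simp
      · rw [← Finset.mul_sum, ih a (by rw [Finset.mem_range] at hj; omega), mul_zero]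
    have h2 : ∀ M : Finset ι, (-1 : ℝ) ^ (M.card + 1) * (a + (-x i + signSum x W M)) ^ k
        = -((-1 : ℝ) ^ M.card * (a + (-x i + signSum x W M)) ^ k) := fun M => by ring
    rw [Finset.sum_congr rfl fun M _ => h2 M, Finset.sum_neg_distrib, key, key, add_neg_cancel]

/-- The indicator of even |M| is (1 + (-1)^|M|)/2, and its alternating part contributes nothing in
degrees below |W|. Octads have eight points, so degrees up to 7 are covered. -/
theorem sum_even_signSum_pow (x : ι → ℝ) (W : Finset ι) {k : ℕ} (hk : k < W.card) :
    ∑ M ∈ W.powerset with Even M.card, signSum x W M ^ k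
      = 1 / 2 * ∑ M ∈ W.powerset, (0 + signSum x W M) ^ k := by
  have h := sum_neg_one_pow_card_mul_signSum_pow x W 0 hk
  have h1 : ∀ M : Finset ι, (if Even M.card then signSum x W M ^ k else 0)
      = 1 / 2 * (0 + signSum x W M) ^ k + 1 / 2 * ((-1 : ℝ) ^ M.card * (0 + signSum x W M) ^ k) := by
    intro M
    split_ifs with hM
    · rw [hM.neg_one_pow]
      ring
    · rw [(Nat.not_even_iff_odd.1 hM).neg_one_pow]
      ring
  rw [Finset.sum_filter, Finset.sum_congr rfl fun M _ => h1 M, Finset.sum_add_distrib,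
    ← Finset.mul_sum, ← Finset.mul_sum, h, mul_zero, add_zero]

end SignSums

/-! ### Sums over a 2-design of subsets -/

section Blocks

variable {ι : Type*} [DecidableEq ι] [Fintype ι] {𝓕 : Finset (Finset ι)} {r l : ℕ}

theorem sum_blocks (h : ∀ i j, (𝓕.filter fun W => i ∈ W ∧ j ∈ W).card = if i = j then r else l)
    (y : ι → ℝ) : ∑ W ∈ 𝓕, ∑ i ∈ W, y i = r * ∑ i, y i := by
  have h1 : ∀ W : Finset ι, ∑ i ∈ W, y i = ∑ i, if i ∈ W then y i else 0 := fun W => by simp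
  rw [Finset.sum_congr rfl fun W _ => h1 W, Finset.sum_comm, Finset.mul_sum]
  refine Finset.sum_congr rfl fun i _ => ?_
  have h2 := h i i
  simp only [and_self, if_true] at h2
  rw [← Finset.sum_filter, Finset.sum_const, h2, nsmul_eq_mul]

/-- In the expanded square a diagonal pair occurs in r blocks and an off-diagonal pair in l blocks.
-/
theorem sum_blocks_sq (h : ∀ i j, (𝓕.filter fun W => i ∈ W ∧ j ∈ W).card = if i = j then r else l)
    (y : ι → ℝ) : ∑ W ∈ 𝓕, (∑ i ∈ W, y i) ^ 2
      = l * (∑ i, y i) ^ 2 + (r - l) * ∑ i, y i ^ 2 := by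
  have h1 : ∀ W : Finset ι, (∑ i ∈ W, y i) ^ 2
      = ∑ i, ∑ j, if i ∈ W ∧ j ∈ W then y i * y j else 0 := by
    intro W
    rw [sq, Finset.sum_mul_sum]
    simp [ite_and]
  rw [Finset.sum_congr rfl fun W _ => h1 W, Finset.sum_comm, sq, Finset.sum_mul_sum,
    Finset.mul_sum, Finset.mul_sum, ← Finset.sum_add_distrib]
  refine Finset.sum_congr rfl fun i _ => ?_
  rw [Finset.sum_comm, Finset.mul_sum]
  have h2 : ∀ j, ∑ W ∈ 𝓕, (if i ∈ W ∧ j ∈ W then y i * y j else 0)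
      = l * (y i * y j) + if i = j then ((r : ℝ) - l) * (y i * y j) else 0 := by
    intro j
    rw [← Finset.sum_filter, Finset.sum_const, h, nsmul_eq_mul]
    split_ifs <;> ring
  rw [Finset.sum_congr rfl fun j _ => h2 j, Finset.sum_add_distrib]
  simp [sq]

end Blocks

/-! ### The minimal vectors of the Barnes–Wall lattice -/

/-- The word of the Reed–Muller code with parameters `(a, b)`. -/
def rmWord (p : ZMod 2 × (Fin 4 → ZMod 2)) (i : Fin 16) : ZMod 2 :=
  p.1 + ∑ j : Fin 4, if (i : ℕ).testBit j then p.2 j else 0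

/-- The support of a word of the Reed–Muller code. -/
def rmSupport (p : ZMod 2 × (Fin 4 → ZMod 2)) : Finset (Fin 16) :=
  Finset.univ.filter fun i => rmWord p i ≠ 0

/-- The supports of the words of weight eight. -/
def rmOctads : Finset (Finset (Fin 16)) :=
  (Finset.univ.filter fun p : ZMod 2 × (Fin 4 → ZMod 2) => p.2 ≠ 0).image rmSupport

theorem card_rmSupport : ∀ p, p.2 ≠ 0 → (rmSupport p).card = 8 := by decide +kernel

/-- Self-orthogonality of the code; it makes the integer inner products of lattice coordinates even.
-/
theorem sum_rmWord_mul : ∀ p q, ∑ i, rmWord p i * rmWord q i = 0 := by decide +kernel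

theorem card_rmOctads : rmOctads.card = 30 := by decide +kernel

/-- The octads are the 30 affine hyperplanes of 𝔽₂⁴, which form a 2-(16, 8, 7) design. -/
theorem card_rmOctads_filter : ∀ i j, (rmOctads.filter fun W => i ∈ W ∧ j ∈ W).card
    = if i = j then 15 else 7 := by decide +kernel

/-- The sets of two coordinates. -/
def coordPairs : Finset (Finset (Fin 16)) := Finset.powersetCard 2 Finset.univ

theorem card_coordPairs : coordPairs.card = 120 := by decide +kernel

theorem card_coordPairs_filter : ∀ i j : Fin 16,
    (coordPairs.filter fun W => i ∈ W ∧ j ∈ W).card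
      = if i = j then 15 else 1 := by decide +kernel

theorem card_of_mem_coordPairs {W : Finset (Fin 16)} (hW : W ∈ coordPairs) : W.card = 2 :=
  (Finset.mem_powersetCard.1 hW).2

theorem mem_coordPairs {W : Finset (Fin 16)} : W ∈ coordPairs ↔ W.card = 2 := by
  simp [coordPairs, Finset.mem_powersetCard]

theorem mem_rmOctads {W : Finset (Fin 16)} : W ∈ rmOctads ↔ ∃ p, p.2 ≠ 0 ∧ rmSupport p = W := by
  simp [rmOctads]

theorem card_of_mem_rmOctads {W : Finset (Fin 16)} (hW : W ∈ rmOctads) : W.card = 8 := by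
  obtain ⟨p, hp, rfl⟩ := mem_rmOctads.1 hW
  exact card_rmSupport p hp

attribute [irreducible] coordPairs rmOctads

theorem mem_reedMuller {c : Fin 16 → ZMod 2} : c ∈ reedMuller ↔ ∃ p, c = rmWord p :=
  ⟨fun ⟨a, b, h⟩ => ⟨(a, b), funext h⟩, fun ⟨p, h⟩ => ⟨p.1, p.2, fun i => congrFun h i⟩⟩

/-- The vector with entries `±m` on `W`, negative on `M`. -/
def signVec (m : ℤ) (W M : Finset (Fin 16)) (i : Fin 16) : ℤ :=
  if i ∈ W then if i ∈ M then -m else m else 0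

/-- Pairs of a support of size two and a set of negative entries. -/
def pairSigns : Finset (Finset (Fin 16) × Finset (Fin 16)) :=
  coordPairs.biUnion fun W => W.powerset.image fun M => (W, M)

/-- Pairs of an octad and an even set of negative entries. -/
def octadSigns : Finset (Finset (Fin 16) × Finset (Fin 16)) :=
  rmOctads.biUnion fun W => (W.powerset.filter fun M => Even M.card).image fun M => (W, M)

theorem mem_pairSigns {p : Finset (Fin 16) × Finset (Fin 16)} :
    p ∈ pairSigns ↔ p.1.card = 2 ∧ p.2 ⊆ p.1 := by
  obtain ⟨W, M⟩ := p
  simp [pairSigns, mem_coordPairs]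

theorem mem_octadSigns {p : Finset (Fin 16) × Finset (Fin 16)} :
    p ∈ octadSigns ↔ p.1 ∈ rmOctads ∧ p.2 ⊆ p.1 ∧ Even p.2.card := by
  obtain ⟨W, M⟩ := p
  simp [octadSigns]

/-- The coordinates, multiplied by `√2`, of the minimal vectors of the Barnes–Wall lattice. -/
def minimalIntVectors : Finset (Fin 16 → ℤ) :=
  pairSigns.image (fun p => signVec 2 p.1 p.2) ∪ octadSigns.image fun p => signVec 1 p.1 p.2

theorem signVec_ne_zero_iff {m : ℤ} (hm : 0 < m) {W M : Finset (Fin 16)} {i : Fin 16} :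
    signVec m W M i ≠ 0 ↔ i ∈ W := by
  unfold signVec
  split_ifs <;> simp_all [hm.ne']

theorem signVec_neg_iff {m : ℤ} (hm : 0 < m) {W M : Finset (Fin 16)} (hM : M ⊆ W) {i : Fin 16} :
    signVec m W M i < 0 ↔ i ∈ M := by
  unfold signVec
  split_ifs with h1 h2
  · simp [hm, h2]
  · simp [hm.le, h2]
  · simpa using fun h => h1 (hM h)

theorem signVec_inj {m : ℤ} (hm : 0 < m) {W M W' M' : Finset (Fin 16)} (hM : M ⊆ W) (hM' : M' ⊆ W')
    (h : signVec m W M = signVec m W' M') : W = W' ∧ M = M' := by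
  constructor
  · ext i
    rw [← signVec_ne_zero_iff hm (M := M), h, signVec_ne_zero_iff hm]
  · ext i
    rw [← signVec_neg_iff hm hM, h, signVec_neg_iff hm hM']

theorem sum_mul_signVec (x : Fin 16 → ℝ) (m : ℤ) {W M : Finset (Fin 16)} (hM : M ⊆ W) :
    ∑ i, x i * (signVec m W M i : ℝ) = m * signSum x W M := by
  have h : ∀ i, x i * (signVec m W M i : ℝ)
      = m * ((if i ∈ W then x i else 0) - 2 * if i ∈ M then x i else 0) := by
    intro i
    unfold signVec
    split_ifs with h1 h2 h2
    · push_cast; ring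
    · ring
    · exact absurd (hM h2) h1
    · simp
  rw [Finset.sum_congr rfl fun i _ => h i, ← Finset.mul_sum, Finset.sum_sub_distrib,
    ← Finset.mul_sum, signSum]
  simp

theorem sum_minimalIntVectors (φ : (Fin 16 → ℤ) → ℝ) :
    ∑ z ∈ minimalIntVectors, φ z
      = (∑ W ∈ coordPairs, ∑ M ∈ W.powerset, φ (signVec 2 W M))
        + ∑ W ∈ rmOctads, ∑ M ∈ W.powerset with Even M.card, φ (signVec 1 W M) := by
  have hpd : ∀ (s : Finset (Finset (Fin 16))) (g : Finset (Fin 16) → Finset (Finset (Fin 16))),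
      (s : Set (Finset (Fin 16))).PairwiseDisjoint fun W => (g W).image fun M => (W, M) := by
    intro s g W _ W' _ hne
    rw [Function.onFun, Finset.disjoint_left]
    intro p hp hp'
    simp only [Finset.mem_image] at hp hp'
    obtain ⟨M, -, rfl⟩ := hp
    obtain ⟨M', -, h⟩ := hp'
    exact hne (congrArg Prod.fst h).symm
  have hinj : ∀ W : Finset (Fin 16), ∀ s : Set (Finset (Fin 16)),
      Set.InjOn (fun M : Finset (Fin 16) => (W, M)) s :=
    fun W s M _ M' _ h => congrArg Prod.snd h
  rw [minimalIntVectors, Finset.sum_union, Finset.sum_image, Finset.sum_image, pairSigns,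
    octadSigns, Finset.sum_biUnion (hpd _ _), Finset.sum_biUnion (hpd _ _)]
  · congr 1
    · exact Finset.sum_congr rfl fun W _ => by rw [Finset.sum_image (hinj W _)]
    · exact Finset.sum_congr rfl fun W _ => by rw [Finset.sum_image (hinj W _)]
  · intro p hp q hq h
    have := signVec_inj one_pos (mem_octadSigns.1 hp).2.1 (mem_octadSigns.1 hq).2.1 h
    exact Prod.ext this.1 this.2
  · intro p hp q hq h
    have := signVec_inj two_pos (mem_pairSigns.1 hp).2 (mem_pairSigns.1 hq).2 h
    exact Prod.ext this.1 this.2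
  -- The two shapes are disjoint because their supports have sizes 2 and 8.
  · rw [Finset.disjoint_left]
    intro z h1 h2
    obtain ⟨p, hp, rfl⟩ := Finset.mem_image.1 h1
    obtain ⟨q, hq, h⟩ := Finset.mem_image.1 h2
    have h3 : p.1 = q.1 := by
      ext i
      rw [← signVec_ne_zero_iff two_pos (M := p.2), ← h, signVec_ne_zero_iff one_pos]
    have h4 := (mem_pairSigns.1 hp).1
    rw [h3, card_of_mem_rmOctads (mem_octadSigns.1 hq).1] at h4
    omega

theorem card_minimalIntVectors : minimalIntVectors.card = 4320 := by
  have h := sum_minimalIntVectors fun _ => 1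
  have h1 : ∀ W ∈ coordPairs,
      ∑ M ∈ W.powerset, (1 : ℝ) = 4 := by
    intro W hW
    rw [Finset.sum_const, Finset.card_powerset, card_of_mem_coordPairs hW]
    norm_num
  have h2 : ∀ W ∈ rmOctads, ∑ M ∈ W.powerset with Even M.card, (1 : ℝ) = 128 := by
    intro W hW
    have h3 := card_of_mem_rmOctads hW
    -- The zeroth power counts the even subsets of an octad: half of 2⁸.
    have := sum_even_signSum_pow (fun _ => 0) W (k := 0) (by omega)
    simp only [pow_zero] at this
    rw [this, Finset.sum_const, Finset.card_powerset, h3]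
    norm_num
  rw [Finset.sum_congr rfl h1, Finset.sum_congr rfl h2, Finset.sum_const, Finset.sum_const,
    Finset.sum_const, card_rmOctads, card_coordPairs] at h
  norm_num at h
  exact_mod_cast h

theorem sum_minimalIntVectors_pow_two (x : Fin 16 → ℝ) :
    ∑ z ∈ minimalIntVectors, (∑ i, x i * (z i : ℝ)) ^ 2 = 2160 * ∑ i, x i ^ 2 := by
  rw [sum_minimalIntVectors]
  have h1 : ∀ W ∈ coordPairs,
      ∑ M ∈ W.powerset, (∑ i, x i * (signVec 2 W M i : ℝ)) ^ 2 = 16 * ∑ i ∈ W, x i ^ 2 := by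
    intro W hW
    have h2 := sum_signSum_pow_two x W 0
    rw [card_of_mem_coordPairs hW] at h2
    rw [Finset.sum_congr rfl fun M hM => by
      rw [sum_mul_signVec x 2 (Finset.mem_powerset.1 hM), mul_pow, ← zero_add (signSum x W M)],
      ← Finset.mul_sum, h2]
    push_cast
    ring
  have h2 : ∀ W ∈ rmOctads, ∑ M ∈ W.powerset with Even M.card,
      (∑ i, x i * (signVec 1 W M i : ℝ)) ^ 2 = 128 * ∑ i ∈ W, x i ^ 2 := by
    intro W hW
    have h3 := card_of_mem_rmOctads hW
    rw [Finset.sum_congr rfl fun M hM => by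
      rw [sum_mul_signVec x 1 (Finset.mem_powerset.1 (Finset.mem_filter.1 hM).1), Int.cast_one,
        one_mul], sum_even_signSum_pow x W (by omega), sum_signSum_pow_two, h3]
    ring
  rw [Finset.sum_congr rfl h1, Finset.sum_congr rfl h2, ← Finset.mul_sum, ← Finset.mul_sum,
    sum_blocks card_coordPairs_filter, sum_blocks card_rmOctads_filter]
  push_cast
  ring

/-- The terms in ∑ xᵢ⁴ cancel between the two shapes: 192·14 - 128·15 + 384·8 - 256·15 = 0. What
remains is 192·1 + 384·7 = 2880 times the square of the norm form. -/
theorem sum_minimalIntVectors_pow_four (x : Fin 16 → ℝ) :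
    ∑ z ∈ minimalIntVectors, (∑ i, x i * (z i : ℝ)) ^ 4 = 2880 * (∑ i, x i ^ 2) ^ 2 := by
  rw [sum_minimalIntVectors]
  have h1 : ∀ W ∈ coordPairs,
      ∑ M ∈ W.powerset, (∑ i, x i * (signVec 2 W M i : ℝ)) ^ 4
        = 192 * (∑ i ∈ W, x i ^ 2) ^ 2 - 128 * ∑ i ∈ W, x i ^ 4 := by
    intro W hW
    have h2 := sum_signSum_pow_four x W 0
    rw [card_of_mem_coordPairs hW] at h2
    rw [Finset.sum_congr rfl fun M hM => by
      rw [sum_mul_signVec x 2 (Finset.mem_powerset.1 hM), mul_pow, ← zero_add (signSum x W M)],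
      ← Finset.mul_sum, h2]
    push_cast
    ring
  have h2 : ∀ W ∈ rmOctads, ∑ M ∈ W.powerset with Even M.card,
      (∑ i, x i * (signVec 1 W M i : ℝ)) ^ 4
        = 384 * (∑ i ∈ W, x i ^ 2) ^ 2 - 256 * ∑ i ∈ W, x i ^ 4 := by
    intro W hW
    have h3 := card_of_mem_rmOctads hW
    rw [Finset.sum_congr rfl fun M hM => by
      rw [sum_mul_signVec x 1 (Finset.mem_powerset.1 (Finset.mem_filter.1 hM).1), Int.cast_one,
        one_mul], sum_even_signSum_pow x W (by omega), sum_signSum_pow_four, h3]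
    ring
  have h5 : ∑ i, (x i ^ 2) ^ 2 = ∑ i, x i ^ 4 := Finset.sum_congr rfl fun i _ => by ring
  rw [Finset.sum_congr rfl h1, Finset.sum_congr rfl h2, Finset.sum_sub_distrib,
    Finset.sum_sub_distrib, ← Finset.mul_sum, ← Finset.mul_sum, ← Finset.mul_sum, ← Finset.mul_sum,
    sum_blocks card_coordPairs_filter, sum_blocks card_rmOctads_filter,
    sum_blocks_sq card_coordPairs_filter, sum_blocks_sq card_rmOctads_filter, h5]
  push_cast
  ring

/-! ### The Barnes–Wall code -/

/-- Integer coordinates (scaled by `√2`) of points of the Barnes–Wall lattice. -/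
def IsBarnesWallInt (z : Fin 16 → ℤ) : Prop :=
  (fun i => (z i : ZMod 2)) ∈ reedMuller ∧ (4 : ℤ) ∣ ∑ i, z i

theorem IsBarnesWallInt.add {z w : Fin 16 → ℤ} (hz : IsBarnesWallInt z) (hw : IsBarnesWallInt w) :
    IsBarnesWallInt (z + w) := by
  refine ⟨?_, ?_⟩
  · have := reedMuller.add_mem hz.1 hw.1
    convert this using 1
    ext i
    simp
  · simpa [Finset.sum_add_distrib] using dvd_add hz.2 hw.2

theorem IsBarnesWallInt.neg {z : Fin 16 → ℤ} (hz : IsBarnesWallInt z) :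
    IsBarnesWallInt (-z) := by
  refine ⟨?_, ?_⟩
  · have := reedMuller.neg_mem hz.1
    convert this using 1
    ext i
    simp
  · simpa using hz.2

theorem sum_signVec (m : ℤ) {W M : Finset (Fin 16)} (hM : M ⊆ W) :
    ∑ i, signVec m W M i = m * (W.card - 2 * M.card) := by
  have h := sum_mul_signVec (fun _ => 1) m hM
  simp only [one_mul, signSum, Finset.sum_const, nsmul_eq_mul, mul_one] at h
  exact_mod_cast h

theorem sum_signVec_sq (m : ℤ) (W M : Finset (Fin 16)) :
    ∑ i, signVec m W M i ^ 2 = m ^ 2 * W.card := by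
  have h : ∀ i, signVec m W M i ^ 2 = if i ∈ W then m ^ 2 else 0 := by
    intro i
    unfold signVec
    split_ifs <;> ring
  rw [Finset.sum_congr rfl fun i _ => h i]
  simp [mul_comm]

theorem eq_signVec {m : ℤ} (hm : 0 < m) {W : Finset (Fin 16)} {z : Fin 16 → ℤ}
    (h1 : ∀ i ∈ W, z i ^ 2 = m ^ 2) (h2 : ∀ i ∉ W, z i = 0) :
    z = signVec m W (W.filter fun i => z i < 0) := by
  ext i
  unfold signVec
  by_cases hi : i ∈ W
  · rcases sq_eq_sq_iff_eq_or_eq_neg.1 (h1 i hi) with h | h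
    · simp [hi, h, hm.le]
    · have : z i < 0 := by omega
      simp [hi, h, hm]
  · simp [hi, h2 i hi]

theorem ZMod.two_eq_one_of_ne_zero : ∀ a : ZMod 2, a ≠ 0 → a = 1 := by decide

theorem isBarnesWallInt_of_mem {z : Fin 16 → ℤ} (hz : z ∈ minimalIntVectors) :
    IsBarnesWallInt z ∧ ∑ i, z i ^ 2 = 8 := by
  rcases Finset.mem_union.1 hz with h | h
  · obtain ⟨p, hp, rfl⟩ := Finset.mem_image.1 h
    obtain ⟨h1, h2⟩ := mem_pairSigns.1 hp
    refine ⟨⟨?_, ?_⟩, ?_⟩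
    · convert reedMuller.zero_mem using 1
      ext i
      have : (2 : ZMod 2) = 0 := rfl
      simp only [signVec]
      split_ifs <;> simp [this]
    · rw [sum_signVec 2 h2, h1]
      exact ⟨1 - p.2.card, by push_cast; ring⟩
    · rw [sum_signVec_sq, h1]
      norm_num
  · obtain ⟨p, hp, rfl⟩ := Finset.mem_image.1 h
    obtain ⟨h1, h2, h3⟩ := mem_octadSigns.1 hp
    have h4 := card_of_mem_rmOctads h1
    refine ⟨⟨?_, ?_⟩, ?_⟩
    · obtain ⟨q, -, hq⟩ := mem_rmOctads.1 h1
      rw [mem_reedMuller]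
      refine ⟨q, ?_⟩
      ext i
      have hi : i ∈ p.1 ↔ rmWord q i ≠ 0 := by rw [← hq]; simp [rmSupport]
      unfold signVec
      by_cases h : i ∈ p.1
      · rw [ZMod.two_eq_one_of_ne_zero _ (hi.1 h), if_pos h]
        split_ifs <;> decide
      · rw [if_neg h, not_not.1 fun h' => h (hi.2 h')]
        simp
    · rw [sum_signVec 1 h2, h4]
      obtain ⟨k, hk⟩ := h3
      exact ⟨2 - k, by rw [hk]; push_cast; ring⟩
    · rw [sum_signVec_sq, h4]
      norm_num

theorem one_le_sq_of_odd {a : ℤ} (h : ¬ 2 ∣ a) : 1 ≤ a ^ 2 := by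
  have : a ≠ 0 := by rintro rfl; simp at h
  have := sq_pos_of_ne_zero (a := a) this
  omega

/-- The minimum of the Barnes–Wall lattice and the vectors that attain it. -/
theorem IsBarnesWallInt.eight_le {z : Fin 16 → ℤ} (hz : IsBarnesWallInt z) (h0 : z ≠ 0) :
    8 ≤ ∑ i, z i ^ 2 ∧ (∑ i, z i ^ 2 = 8 → z ∈ minimalIntVectors) := by
  obtain ⟨p, hp⟩ := mem_reedMuller.1 hz.1
  have hpar : ∀ i, rmWord p i = 0 ↔ (2 : ℤ) ∣ z i := by
    intro i
    rw [← congrFun hp i]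
    exact ZMod.intCast_zmod_eq_zero_iff_dvd (z i) 2
  -- The reduction of z mod 2 is the zero word, the all-one word, or a word of weight 8.
  by_cases hb : p.2 = 0
  · have hc : ∀ i, rmWord p i = p.1 := fun i => by simp [rmWord, hb]
    by_cases ha : p.1 = 0
    · have hev : ∀ i, (2 : ℤ) ∣ z i := fun i => (hpar i).1 ((hc i).trans ha)
      choose w hw using hev
      have hsum : ∑ i, z i = 2 * ∑ i, w i := by
        rw [Finset.mul_sum]
        exact Finset.sum_congr rfl fun i _ => hw i
      have hsq : ∑ i, z i ^ 2 = 4 * ∑ i, w i ^ 2 := by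
        rw [Finset.mul_sum]
        exact Finset.sum_congr rfl fun i _ => by rw [hw i]; ring
      have h1 : (2 : ℤ) ∣ ∑ i, w i := by
        have := hz.2
        rw [hsum] at this
        omega
      -- Here z = 2w. Since w² ≡ w mod 2 and ∑ wᵢ is even, ∑ wᵢ² is even and positive, hence at
      -- least 2; equality forces two entries ±1.
      have h2 : (2 : ℤ) ∣ ∑ i, w i ^ 2 := by
        have : ∑ i, w i ^ 2 = ∑ i, w i * (w i - 1) + ∑ i, w i := by
          rw [← Finset.sum_add_distrib]
          exact Finset.sum_congr rfl fun i _ => by ring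
        rw [this]
        refine dvd_add (Finset.dvd_sum fun i _ => ?_) h1
        exact even_iff_two_dvd.1 (Int.even_mul_pred_self _)
      have h3 : 0 < ∑ i, w i ^ 2 := by
        obtain ⟨i, hi⟩ := Function.ne_iff.1 h0
        refine Finset.sum_pos' (fun j _ => sq_nonneg _) ⟨i, Finset.mem_univ _, ?_⟩
        refine sq_pos_of_ne_zero fun h => hi ?_
        rw [hw i, h]
        rfl
      refine ⟨by omega, fun h8 => ?_⟩
      have h4 : ∑ i, w i ^ 2 = 2 := by omega
      set W := Finset.univ.filter fun i => w i ≠ 0 with hW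
      have h5 : ∀ i, w i ^ 2 = if w i ≠ 0 then 1 else 0 := by
        intro i
        have h6 : w i ^ 2 ≤ 2 := h4 ▸
          Finset.single_le_sum (f := fun i => w i ^ 2) (fun j _ => sq_nonneg _) (Finset.mem_univ i)
        have h7 : w i ≤ 1 := by nlinarith
        have h8 : -1 ≤ w i := by nlinarith
        obtain h | h | h : w i = -1 ∨ w i = 0 ∨ w i = 1 := by omega
        all_goals simp [h]
      have hcard : W.card = 2 := by
        rw [Finset.sum_congr rfl fun i _ => h5 i, ← Finset.sum_filter] at h4
        simp only [Finset.sum_const, mul_one, nsmul_eq_mul] at h4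
        exact_mod_cast h4
      refine Finset.mem_union_left _ (Finset.mem_image.2 ⟨(W, W.filter fun i => z i < 0), ?_, ?_⟩)
      · exact mem_pairSigns.2 ⟨hcard, Finset.filter_subset _ _⟩
      · refine (eq_signVec two_pos (fun i hi => ?_) fun i hi => ?_).symm
        · have h6 := h5 i
          rw [if_pos (Finset.mem_filter.1 hi).2] at h6
          rw [hw i, mul_pow, h6, mul_one]
        · have : w i = 0 := by simpa [hW] using hi
          rw [hw i, this, mul_zero]
    -- For the all-one word every entry is odd, so the square norm is at least 16 and equality with
    -- 8 is impossible.
    · have h1 : ∀ i, 1 ≤ z i ^ 2 := fun i =>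
        one_le_sq_of_odd fun h => ha ((hc i).symm.trans ((hpar i).2 h))
      have h2 : ∑ i : Fin 16, (1 : ℤ) ≤ ∑ i, z i ^ 2 := Finset.sum_le_sum fun i _ => h1 i
      simp only [Finset.sum_const, Finset.card_univ, Fintype.card_fin] at h2
      norm_num at h2
      exact ⟨by omega, fun h => by omega⟩
  · set W := rmSupport p with hW
    have hcard : W.card = 8 := card_rmSupport p hb
    have hmem : ∀ i, i ∈ W ↔ ¬ (2 : ℤ) ∣ z i := by
      intro i
      rw [← hpar i]
      simp [hW, rmSupport]
    -- Entries on the octad are odd, so their squares are at least 1. Square norm 8 leaves no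
    -- excess: the entries are ±1 on the octad and 0 elsewhere.
    have hnn : ∀ i, 0 ≤ z i ^ 2 - if i ∈ W then 1 else 0 := by
      intro i
      split_ifs with h
      · exact sub_nonneg.2 (one_le_sq_of_odd ((hmem i).1 h))
      · simpa using sq_nonneg _
    have hs : ∑ i, (z i ^ 2 - if i ∈ W then 1 else 0) = ∑ i, z i ^ 2 - 8 := by
      rw [Finset.sum_sub_distrib]
      simp [hcard]
    have hge := Finset.sum_nonneg fun i (_ : i ∈ Finset.univ) => hnn i
    refine ⟨by omega, fun h8 => ?_⟩
    rw [h8, sub_self] at hs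
    have hz0 := fun i => (Finset.sum_eq_zero_iff_of_nonneg fun i _ => hnn i).1 hs i (Finset.mem_univ i)
    have hsub : (W.filter fun i => z i < 0) ⊆ W := Finset.filter_subset _ _
    have heq : z = signVec 1 W (W.filter fun i => z i < 0) := by
      refine eq_signVec one_pos (fun i hi => ?_) fun i hi => ?_
      · have := hz0 i
        rw [if_pos hi] at this
        omega
      · have := hz0 i
        rw [if_neg hi, sub_zero] at this
        exact pow_eq_zero_iff two_ne_zero |>.1 this
    refine Finset.mem_union_right _ (Finset.mem_image.2 ⟨(W, W.filter fun i => z i < 0), ?_, heq.symm⟩)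
    refine mem_octadSigns.2 ⟨mem_rmOctads.2 ⟨p, hb, rfl⟩, hsub, ?_⟩
    -- The coordinate sum is 8 - 2|M|, so divisibility by 4 forces |M| to be even.
    have h4 := hz.2
    rw [heq, sum_signVec 1 hsub, hcard] at h4
    rw [Nat.even_iff]
    push_cast at h4
    simp only at h4 ⊢
    omega

theorem neg_mem_minimalIntVectors {z : Fin 16 → ℤ} (hz : z ∈ minimalIntVectors) :
    -z ∈ minimalIntVectors := by
  obtain ⟨h1, h2⟩ := isBarnesWallInt_of_mem hz
  refine (h1.neg.eight_le ?_).2 (by simpa using h2)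
  intro h
  rw [neg_eq_zero.1 h] at h2
  simp at h2

theorem two_dvd_sum_mul {z w : Fin 16 → ℤ} (hz : IsBarnesWallInt z) (hw : IsBarnesWallInt w) :
    (2 : ℤ) ∣ ∑ i, z i * w i := by
  obtain ⟨p, hp⟩ := mem_reedMuller.1 hz.1
  obtain ⟨q, hq⟩ := mem_reedMuller.1 hw.1
  rw [← Nat.cast_ofNat, ← ZMod.intCast_zmod_eq_zero_iff_dvd, ← sum_rmWord_mul p q, ← hp, ← hq]
  push_cast
  rfl

/-- Inner products of distinct minimal vectors. -/
theorem sum_mul_of_mem_minimalIntVectors {z w : Fin 16 → ℤ} (hz : z ∈ minimalIntVectors)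
    (hw : w ∈ minimalIntVectors) (hne : z ≠ w) :
    ∑ i, z i * w i ∈ ({-8, -4, -2, 0, 2, 4} : Set ℤ) := by
  obtain ⟨z1, z2⟩ := isBarnesWallInt_of_mem hz
  obtain ⟨w1, w2⟩ := isBarnesWallInt_of_mem hw
  -- The inner product is even. As z - w is a nonzero lattice vector, 16 - 2⟨z,w⟩ ≥ 8; as z + w is
  -- one unless w = -z, also 16 + 2⟨z,w⟩ ≥ 8. The exceptional case gives -8.
  have h1 := two_dvd_sum_mul z1 w1
  have h2 := ((z1.add w1.neg).eight_le (by rwa [← sub_eq_add_neg, sub_ne_zero])).1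
  have e1 : ∑ i, (z + -w) i ^ 2 = 16 - 2 * ∑ i, z i * w i := by
    rw [show (16 : ℤ) = ∑ i, z i ^ 2 + ∑ i, w i ^ 2 by rw [z2, w2]; norm_num, Finset.mul_sum,
      ← Finset.sum_add_distrib, ← Finset.sum_sub_distrib]
    exact Finset.sum_congr rfl fun i _ => by simp only [Pi.add_apply, Pi.neg_apply]; ring
  have e2 : ∑ i, (z + w) i ^ 2 = 16 + 2 * ∑ i, z i * w i := by
    rw [show (16 : ℤ) = ∑ i, z i ^ 2 + ∑ i, w i ^ 2 by rw [z2, w2]; norm_num, Finset.mul_sum,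
      ← Finset.sum_add_distrib, ← Finset.sum_add_distrib]
    exact Finset.sum_congr rfl fun i _ => by simp only [Pi.add_apply]; ring
  simp only [Set.mem_insert_iff, Set.mem_singleton_iff]
  by_cases h0 : z + w = 0
  · rw [h0] at e2
    simp only [Pi.zero_apply, ne_eq, OfNat.ofNat_ne_zero, not_false_eq_true, zero_pow,
      Finset.sum_const_zero] at e2
    omega
  · have h3 := ((z1.add w1).eight_le h0).1
    omega

/-- The point of the unit sphere given by a minimal vector. -/
def barnesWallPoint (z : Fin 16 → ℤ) : EuclideanSpace ℝ (Fin 16) :=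
  -- A minimal vector z/√2 has squared norm 8/2 = 4, hence the factor 1/2.
  WithLp.toLp 2 fun i => 2⁻¹ * ((z i : ℝ) / √2)

theorem barnesWallPoint_injective : Function.Injective barnesWallPoint := by
  intro z w h
  ext i
  have h1 := congrArg (fun v : EuclideanSpace ℝ (Fin 16) => v i) h
  simp only [barnesWallPoint] at h1
  have h2 : √2 ≠ 0 := by positivity
  field_simp at h1
  exact_mod_cast h1

theorem inner_barnesWallPoint (z w : Fin 16 → ℤ) :
    (inner ℝ (barnesWallPoint z) (barnesWallPoint w) : ℝ)
      = (∑ i, (z i : ℝ) * (w i : ℝ)) / 8 := by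
  rw [EuclideanSpace.inner_eq_sum_mul, Finset.sum_div]
  refine Finset.sum_congr rfl fun i _ => ?_
  have : √2 * √2 = 2 := Real.mul_self_sqrt (by norm_num)
  simp only [barnesWallPoint]
  rw [show 2⁻¹ * ((z i : ℝ) / √2) * (2⁻¹ * ((w i : ℝ) / √2)) = z i * w i / (4 * (√2 * √2)) by
    field_simp; ring, this]
  norm_num

theorem norm_sq_of_eq_div {v : EuclideanSpace ℝ (Fin 16)} {z : Fin 16 → ℤ}
    (h : ∀ i, v i = (z i : ℝ) / √2) : ‖v‖ ^ 2 = ((∑ i, z i ^ 2 : ℤ) : ℝ) / 2 := by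
  rw [EuclideanSpace.real_norm_sq_eq]
  push_cast
  rw [Finset.sum_div]
  refine Finset.sum_congr rfl fun i _ => ?_
  rw [h i, div_pow, Real.sq_sqrt (by norm_num)]

theorem ne_zero_of_eq_div {v : EuclideanSpace ℝ (Fin 16)} {z : Fin 16 → ℤ}
    (h : ∀ i, v i = (z i : ℝ) / √2) : v ≠ 0 ↔ z ≠ 0 := by
  rw [not_iff_not]
  have h2 : √2 ≠ 0 := by positivity
  constructor
  · rintro rfl
    ext i
    have := h i
    simp only [PiLp.zero_apply] at this
    rw [eq_comm, div_eq_zero_iff] at this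
    exact_mod_cast this.resolve_right h2
  · rintro rfl
    ext i
    simp [h i]

theorem mem_minimalVectors_barnesWall {v : EuclideanSpace ℝ (Fin 16)} :
    v ∈ minimalVectors barnesWallLattice ↔
      ∃ z ∈ minimalIntVectors, ∀ i, v i = (z i : ℝ) / √2 := by
  constructor
  · rintro ⟨⟨z, h1, h2, h3⟩, h4, h5⟩
    have hz : IsBarnesWallInt z := ⟨h1, h2⟩
    obtain ⟨hz1, hz2⟩ := hz.eight_le ((ne_zero_of_eq_div h3).1 h4)
    refine ⟨z, hz2 (le_antisymm ?_ hz1), h3⟩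
    obtain ⟨y, hy⟩ : minimalIntVectors.Nonempty :=
      Finset.card_pos.1 (by rw [card_minimalIntVectors]; norm_num)
    obtain ⟨hy1, hy2⟩ := isBarnesWallInt_of_mem hy
    have hy0 : y ≠ 0 := by rintro rfl; simp at hy2
    have hu : ∀ i, (WithLp.toLp 2 fun i => (y i : ℝ) / √2 : EuclideanSpace ℝ (Fin 16)) i
      = (y i : ℝ) / √2 := fun i => rfl
    have h6 := h5 _ ⟨y, hy1.1, hy1.2, hu⟩ ((ne_zero_of_eq_div hu).2 hy0)
    have h7 := pow_le_pow_left₀ (norm_nonneg _) h6 2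
    rw [norm_sq_of_eq_div h3, norm_sq_of_eq_div hu, hy2] at h7
    exact_mod_cast (div_le_div_iff_of_pos_right (zero_lt_two' ℝ)).1 h7
  · rintro ⟨z, hz, h3⟩
    obtain ⟨hz1, hz2⟩ := isBarnesWallInt_of_mem hz
    have hz0 : z ≠ 0 := by rintro rfl; simp at hz2
    refine ⟨⟨z, hz1.1, hz1.2, h3⟩, (ne_zero_of_eq_div h3).2 hz0, ?_⟩
    rintro w ⟨y, hy1, hy2, hy3⟩ hw
    have hy : IsBarnesWallInt y := ⟨hy1, hy2⟩
    have h8 := (hy.eight_le ((ne_zero_of_eq_div hy3).1 hw)).1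
    refine (sq_le_sq₀ (norm_nonneg _) (norm_nonneg _)).1 ?_
    rw [norm_sq_of_eq_div h3, norm_sq_of_eq_div hy3, hz2]
    exact (div_le_div_iff_of_pos_right (zero_lt_two' ℝ)).2 (by exact_mod_cast h8)

open Classical in
theorem barnesWallCode_eq : barnesWallCode = minimalIntVectors.image barnesWallPoint := by
  have hnorm : ∀ z ∈ minimalIntVectors, ∀ v : EuclideanSpace ℝ (Fin 16),
      (∀ i, v i = (z i : ℝ) / √2) → ‖v‖⁻¹ • v = barnesWallPoint z := by
    intro z hz v hv
    have h1 := norm_sq_of_eq_div hv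
    rw [(isBarnesWallInt_of_mem hz).2] at h1
    have h2 : ‖v‖ = 2 := by
      rw [← Real.sqrt_sq (norm_nonneg v), h1]
      rw [show ((8 : ℤ) : ℝ) / 2 = 2 ^ 2 by norm_num]
      exact Real.sqrt_sq (by norm_num)
    ext i
    rw [h2]
    simp [barnesWallPoint, hv i]
  ext u
  rw [barnesWallCode, Set.Finite.mem_toFinset, Finset.mem_image, kissingConfiguration]
  constructor
  · rintro ⟨v, hv, rfl⟩
    obtain ⟨z, hz, h⟩ := mem_minimalVectors_barnesWall.1 hv
    exact ⟨z, hz, (hnorm z hz v h).symm⟩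
  · rintro ⟨z, hz, rfl⟩
    exact ⟨WithLp.toLp 2 fun i => (z i : ℝ) / √2,
      mem_minimalVectors_barnesWall.2 ⟨z, hz, fun i => rfl⟩, hnorm z hz _ fun i => rfl⟩

theorem mem_barnesWallCode {x : EuclideanSpace ℝ (Fin 16)} :
    x ∈ barnesWallCode ↔ ∃ z ∈ minimalIntVectors, barnesWallPoint z = x := by
  rw [barnesWallCode_eq, Finset.mem_image]

theorem card_barnesWallCode : barnesWallCode.card = 4320 := by
  rw [barnesWallCode_eq, Finset.card_image_of_injective _ barnesWallPoint_injective,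
    card_minimalIntVectors]

theorem sum_barnesWallCode (φ : EuclideanSpace ℝ (Fin 16) → ℝ) :
    ∑ y ∈ barnesWallCode, φ y = ∑ z ∈ minimalIntVectors, φ (barnesWallPoint z) := by
  rw [barnesWallCode_eq, Finset.sum_image barnesWallPoint_injective.injOn]

theorem isSphericalCode_barnesWallCode : IsSphericalCode barnesWallCode := by
  intro x hx
  obtain ⟨z, hz, rfl⟩ := mem_barnesWallCode.1 hx
  have h2 : ∑ i, (z i : ℝ) * (z i : ℝ) = 8 := by
    have := (isBarnesWallInt_of_mem hz).2
    simp only [sq] at this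
    exact_mod_cast this
  have h := real_inner_self_eq_norm_sq (barnesWallPoint z)
  rw [inner_barnesWallPoint, h2, div_self (by norm_num)] at h
  exact (pow_eq_one_iff_of_nonneg (norm_nonneg _) two_ne_zero).1 h.symm

theorem innerProducts_barnesWallCode_subset :
    innerProducts barnesWallCode ⊆ barnesWallInnerProducts := by
  rintro t ⟨x, hx, y, hy, hxy, rfl⟩
  obtain ⟨z, hz, rfl⟩ := mem_barnesWallCode.1 hx
  obtain ⟨w, hw, rfl⟩ := mem_barnesWallCode.1 hy
  have h := sum_mul_of_mem_minimalIntVectors hz hw fun h => hxy (by rw [h])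
  have e : ∑ i, (z i : ℝ) * (w i : ℝ) = ((∑ i, z i * w i : ℤ) : ℝ) := by push_cast; rfl
  rw [inner_barnesWallPoint, e]
  simp only [barnesWallInnerProducts, Set.mem_insert_iff, Set.mem_singleton_iff] at h ⊢
  rcases h with h | h | h | h | h | h <;> rw [h] <;> norm_num

/-! ### Moments and distance distribution of the Barnes–Wall code -/

theorem sum_minimalIntVectors_pow_odd (x : Fin 16 → ℝ) {k : ℕ} (hk : Odd k) :
    ∑ z ∈ minimalIntVectors, (∑ i, x i * (z i : ℝ)) ^ k = 0 := by
  have h : ∑ z ∈ minimalIntVectors, (∑ i, x i * (z i : ℝ)) ^ k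
      = ∑ z ∈ minimalIntVectors, -(∑ i, x i * (z i : ℝ)) ^ k := by
    refine Finset.sum_nbij' (fun z => -z) (fun z => -z) (fun z => neg_mem_minimalIntVectors)
      (fun z => neg_mem_minimalIntVectors) (fun z _ => neg_neg z) (fun z _ => neg_neg z) ?_
    intro z _
    rw [← hk.neg_pow, ← Finset.sum_neg_distrib]
    simp
  rw [Finset.sum_neg_distrib] at h
  linarith

/-- Odd moments vanish by central symmetry. The even ones needed are 2160·8/8² = 270 and 2880·8²/8⁴
= 45. -/
theorem hasBarnesWallDistribution_barnesWallCode : HasBarnesWallDistribution barnesWallCode := by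
  have hsum : ∀ z : Fin 16 → ℤ, ∀ k : ℕ,
      ∑ y ∈ barnesWallCode, (inner ℝ (barnesWallPoint z) y : ℝ) ^ k
        = (∑ w ∈ minimalIntVectors, (∑ i, (z i : ℝ) * (w i : ℝ)) ^ k) / 8 ^ k := by
    intro z k
    rw [sum_barnesWallCode, Finset.sum_div]
    exact Finset.sum_congr rfl fun w _ => by rw [inner_barnesWallPoint, div_pow]
  have hsq : ∀ z ∈ minimalIntVectors, ∑ i, (z i : ℝ) ^ 2 = 8 := fun z hz => by
    exact_mod_cast (isBarnesWallInt_of_mem hz).2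
  have hodd : ∀ k : ℕ, Odd k → ∀ x ∈ barnesWallCode,
      ∑ y ∈ barnesWallCode, (inner ℝ x y : ℝ) ^ k = 0 := by
    intro k hk x hx
    obtain ⟨z, hz, rfl⟩ := mem_barnesWallCode.1 hx
    rw [hsum, sum_minimalIntVectors_pow_odd _ hk, zero_div]
  refine hasBarnesWallDistribution_of_moments isSphericalCode_barnesWallCode card_barnesWallCode
    innerProducts_barnesWallCode_subset ?_ ?_ (hodd 3 (by decide)) ?_ (hodd 5 (by decide))
  · intro x hx
    simpa using hodd 1 (by decide) x hx
  · intro x hx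
    obtain ⟨z, hz, rfl⟩ := mem_barnesWallCode.1 hx
    rw [hsum, sum_minimalIntVectors_pow_two, hsq z hz]
    norm_num
  · intro x hx
    obtain ⟨z, hz, rfl⟩ := mem_barnesWallCode.1 hx
    rw [hsum, sum_minimalIntVectors_pow_four, hsq z hz]
    norm_num

theorem isAvoiding_of_innerProducts_subset {T : Set ℝ} (hT : T ∈ avoidedSets)
    {C : Finset (EuclideanSpace ℝ (Fin 16))} (hI : innerProducts C ⊆ barnesWallInnerProducts) :
    IsAvoiding T C := by
  refine Set.eq_empty_of_forall_notMem fun t ht => ?_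
  obtain ⟨h1, h2⟩ := ht
  rcases hT with rfl | rfl | rfl <;> rcases hI h1 with rfl | rfl | rfl | rfl | rfl | rfl <;>
    norm_num at h2
end

theorem mainTheorem5 (T : Set ℝ) (hT : T ∈ avoidedSets) :
    (∀ h : ℝ → ℝ, IsAbsolutelyMonotone h →
      (∀ t ∈ Set.Ioo (-1 : ℝ) 1, 0 < iteratedDeriv 8 h t) →
        (∀ C : Finset (EuclideanSpace ℝ (Fin 16)),
          IsSphericalCode C → IsAvoiding T C → C.card = 4320 →
            barnesWallBound h ≤ energy h C) ∧
        IsLeast (avoidingEnergies 16 4320 T h) (barnesWallBound h) ∧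
        (∀ C : Finset (EuclideanSpace ℝ (Fin 16)),
          C.card = 4320 → IsSphericalDesign 7 C → innerProducts C = barnesWallInnerProducts →
            IsDistanceInvariant C ∧ HasBarnesWallDistribution C ∧
              energy h C = barnesWallBound h) ∧
        energy h barnesWallCode = barnesWallBound h) ∧
    barnesWallCode.card = 4320 ∧
    innerProducts barnesWallCode = barnesWallInnerProducts ∧
    HasBarnesWallDistribution barnesWallCode ∧
    IsAvoidingUniversallyOptimal T barnesWallCode := by
  have hC := isSphericalCode_barnesWallCode
  have hN := card_barnesWallCode
  have hI := innerProducts_barnesWallCode_subset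
  have hD := hasBarnesWallDistribution_barnesWallCode
  have hav := isAvoiding_of_innerProducts_subset hT hI
  have henergy := energy_eq_barnesWallBound hC hN hI hD
  refine ⟨fun h hh _ => ⟨fun C h1 h2 h3 => barnesWallBound_le_energy hT hh h1 h2 h3,
    ⟨⟨_, hC, hav, hN, henergy h⟩, ?_⟩, fun C h1 h2 h3 => ?_, henergy h⟩, hN,
    innerProducts_eq_of_distribution hC hN hI hD, hD, hC, hav, fun h hh C h1 h2 h3 => ?_⟩
  · rintro _ ⟨C, h1, h2, h3, rfl⟩
    exact barnesWallBound_le_energy hT hh h1 h2 h3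
  · have hD' := h2.hasBarnesWallDistribution h1 h3.subset
    exact ⟨isDistanceInvariant_of_distribution h3.subset hD', hD',
      energy_eq_barnesWallBound h2.1 h1 h3.subset hD' h⟩
  · rw [henergy h]
    exact barnesWallBound_le_energy hT hh h1 h2 (h3.trans hN)
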